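/- Let $\mathcal K=L^2((0,\infty),dr/r)$, let $\Pi=\{z=x+iy: y>0\}$ and $d\omega(z)=dx\,dy/y$ on $\Pi$. For $a>0$, $b\in\mathbb R$ let $U(a,b)\psi(r)=e^{2\pi i br}\psi(ar)$ on $\mathcal K$, let $\lambda(t)=t/(1-e^{-t})$, $\lambda(0)=1$, and let $W(u,v)=U(e^u,\,ve^u/\lambda(u))$, $u,v\in\mathbb R$, be the Weyl operators. The Stratonovich–Weyl quantizer is $$\Omega(z)=|y|\iint_{\mathbb R^2}e^{-2\pi i(ux+vy)}\,W(u,v)\,du\,dv,\qquad z=x+iy\in\Pi ,$$ understood weakly: for test functions $\varphi,\psi\in\mathcal D(0,\infty)$ put $\langle\varphi,\Omega(z)\psi\rangle=|y|\iint e^{-2\pi i(ux+vy)}\langle\varphi,W(u,v)\psi\rangle\,du\,dv$. For a function $f$ on $\Pi$, $Q(f)=\int_\Pi\Omega(z)f(z)\,d\omega(z)$ denotes the bounded operator with $\langle\varphi,Q(f)\psi\rangle=\int_\Pi\langle\varphi,\Omega(z)\psi\rangle f(z)\,d\omega(z)$, with an absolutely convergent integral, for all $\varphi,\psi\in\mathcal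 D(0,\infty)$. For a Hilbert–Schmidt operator $A$ on $\mathcal K$, $W_A(z)=\operatorname{Tr}(\Omega(z)A)$ denotes the distribution $f\mapsto\operatorname{Tr}(Q(f)A)$, $f\in\mathcal D(\Pi)$, functions $F$ on $\Pi$ being identified with the distributions $f\mapsto\int_\Pi fF\,d\omega$. Then: (1) For all $z\in\Pi$ and $\varphi,\psi\in\mathcal D(0,\infty)$ the integral that defines $\langle\varphi,\Omega(z)\psi\rangle$ converges absolutely. (2) (Traciality.) $\operatorname{Tr}(\Omega(w)\Omega(z))=y\,\delta(w-z)$, the reproducing kernel of $L^2(\Pi,d\omega)$, in the sense of distributions: for all $f,h\in\mathcal D(\Pi)$ the bounded operators $Q(f)$, $Q(h)$ exist, $Q(f)Q(h)$ is of trace class, and $$\operatorname{Tr}\bigl(Q(f)Q(h)\bigr)=\int_\Pi f(z)\,h(z)\,d\omega(z).$$ (3) For every $f\in L^2(\Pi,d\omega)$ the operator $Q(f)$ exists, is unique and is Hilbert–Schmidt; for every Hilbert–Schmidt operator $A$ on $\mathcal K$ the distribution $W_A$ is given by a unique element of $L^2(\Pi,d\omega)$. The maps $f\mapsto Q(f)$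 and $A\mapsto W_A$ are mutually inverse isometric linear isomorphisms between $L^2(\Pi,d\omega)$ and the Hilbert space of Hilbert–Schmidt operators on $\mathcal K$ with inner product $\operatorname{Tr}(A^\dagger B)$, and $\operatorname{Tr}(Q(f)Q(h))=\int_\Pi f\,h\,d\omega$ for all $f,h\in L^2(\Pi,d\omega)$. -/

import Mathlib

open MeasureTheory Set
open scoped Distributions ContDiff ENNReal

universe u

/-! ### Hilbert–Schmidt operators and the trace -/

/-- The Hilbert–Schmidt operators on a Hilbert space `H`: the bounded operators `A` with
`∑ ‖A eᵢ‖² < ∞` for the orthonormal bases `(eᵢ)` of `H`. -/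
def hsSubmodule (H : Type u) [NormedAddCommGroup H] [InnerProductSpace ℂ H] :
    Submodule ℂ (H →L[ℂ] H) where
  carrier := {A | ∀ (ι : Type u) (e : HilbertBasis ι ℂ H), Summable fun i => ‖A (e i)‖ ^ 2}
  zero_mem' := by
    intro ι e
    simp
  add_mem' := by
    intro A B hA hB ι e
    refine Summable.of_nonneg_of_le (fun i => by positivity) (fun i => ?_)
      (((hA ι e).add (hB ι e)).mul_left 2)
    have h := norm_add_le (A (e i)) (B (e i))
    have h0 := norm_nonneg (A (e i) + B (e i))
    change ‖A (e i) + B (e i)‖ ^ 2 ≤ _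
    nlinarith [sq_nonneg (‖A (e i)‖ - ‖B (e i)‖)]
  smul_mem' := by
    intro c A hA ι e
    refine ((hA ι e).mul_left (‖c‖ ^ 2)).congr fun i => ?_
    simp [norm_smul, mul_pow]

/-- The type of Hilbert–Schmidt operators on `H`. It is given the Hilbert–Schmidt norm, not the
operator norm. -/
def HilbertSchmidt (H : Type u) [NormedAddCommGroup H] [InnerProductSpace ℂ H] : Type u :=
  hsSubmodule H

namespace HilbertSchmidt

section

variable {H : Type u} [NormedAddCommGroup H] [InnerProductSpace ℂ H]

instance : AddCommGroup (HilbertSchmidt H) := inferInstanceAs (AddCommGroup (hsSubmodule H))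

instance : Module ℂ (HilbertSchmidt H) := inferInstanceAs (Module ℂ (hsSubmodule H))

/-- The underlying bounded operator of a Hilbert–Schmidt operator. -/
def toOp : HilbertSchmidt H →ₗ[ℂ] (H →L[ℂ] H) := (hsSubmodule H).subtype

theorem toOp_injective : Function.Injective (toOp (H := H)) := Subtype.val_injective

theorem summable_sq (A : HilbertSchmidt H) {ι : Type u} (e : HilbertBasis ι ℂ H) :
    Summable fun i => ‖toOp A (e i)‖ ^ 2 := A.2 ι e

theorem summable_inner (A B : HilbertSchmidt H) {ι : Type u} (e : HilbertBasis ι ℂ H) :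
    Summable fun i => inner ℂ (toOp A (e i)) (toOp B (e i)) := by
  refine Summable.of_norm_bounded ((A.summable_sq e).add (B.summable_sq e)) fun i => ?_
  refine (norm_inner_le_norm _ _).trans ?_
  nlinarith [sq_nonneg (‖toOp A (e i)‖ - ‖toOp B (e i)‖), sq_nonneg ‖toOp A (e i)‖,
    sq_nonneg ‖toOp B (e i)‖]

end

section

variable (H : Type u) [NormedAddCommGroup H] [InnerProductSpace ℂ H] [CompleteSpace H]

/-- The index set of some orthonormal basis of `H`. -/
def basisIndex : Set H := (exists_hilbertBasis ℂ H).choose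

/-- Some orthonormal basis of `H`. -/
noncomputable def basis : HilbertBasis (basisIndex H) ℂ H :=
  (exists_hilbertBasis ℂ H).choose_spec.choose

variable {H}

/-- The Hilbert–Schmidt inner product `⟨A, B⟩ = ∑ ⟨A eᵢ, B eᵢ⟩ = Tr(A† B)`; the sum is absolutely convergent
and the same for every orthonormal basis `(eᵢ)`. -/
@[reducible] noncomputable def innerCore : InnerProductSpace.Core ℂ (HilbertSchmidt H) where
  inner A B := ∑' i, inner ℂ (toOp A (basis H i)) (toOp B (basis H i))
  conj_inner_symm A B := by
    rw [Complex.conj_tsum]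
    simp
  re_inner_nonneg A := by
    have h : ∑' i, inner ℂ (toOp A (basis H i)) (toOp A (basis H i)) =
        ((∑' i, ‖toOp A (basis H i)‖ ^ 2 : ℝ) : ℂ) := by
      rw [Complex.ofReal_tsum]
      exact tsum_congr fun i => by rw [inner_self_eq_norm_sq_to_K]; norm_cast
    rw [h]
    exact tsum_nonneg fun i => by positivity
  add_left A B C := by
    rw [← (A.summable_inner C (basis H)).tsum_add (B.summable_inner C (basis H))]
    simp
  smul_left A B c := by
    rw [← tsum_mul_left]
    simp [mul_comm]
  definite A hA := by
    have h : ∑' i, inner ℂ (toOp A (basis H i)) (toOp A (basis H i)) =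
        ((∑' i, ‖toOp A (basis H i)‖ ^ 2 : ℝ) : ℂ) := by
      rw [Complex.ofReal_tsum]
      exact tsum_congr fun i => by rw [inner_self_eq_norm_sq_to_K]; norm_cast
    have h0 : ∑' i, ‖toOp A (basis H i)‖ ^ 2 = 0 := by
      have := h.symm.trans hA
      exact_mod_cast this
    have h1 : ∀ i, toOp A (basis H i) = 0 := by
      intro i
      have h2 := (hasSum_zero_iff_of_nonneg (fun i => by positivity)).1
        (h0 ▸ (A.summable_sq (basis H)).hasSum)
      have h3 := congrFun h2 i
      simpa using h3
    apply toOp_injective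
    rw [map_zero]
    refine ContinuousLinearMap.ext_on (s := range (basis H)) ?_ ?_
    · have := (basis H).dense_span
      rw [Submodule.dense_iff_topologicalClosure_eq_top]
      exact this
    · rintro _ ⟨i, rfl⟩
      simpa using h1 i

noncomputable instance : NormedAddCommGroup (HilbertSchmidt H) :=
  innerCore.toNormedAddCommGroup

noncomputable instance : InnerProductSpace ℂ (HilbertSchmidt H) :=
  InnerProductSpace.ofCore innerCore.toCore

end

end HilbertSchmidt

/-- `T` is a trace-class operator with trace `c`: for every orthonormal basis `(eᵢ)` the series
`∑ ⟨eᵢ, T eᵢ⟩` converges unconditionally with sum `c` (convergence for all orthonormal bases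
characterizes the trace class). -/
def HasTrace {H : Type u} [NormedAddCommGroup H] [InnerProductSpace ℂ H]
    (T : H →L[ℂ] H) (c : ℂ) : Prop :=
  ∀ (ι : Type u) (e : HilbertBasis ι ℂ H), HasSum (fun i => inner ℂ (e i) (T (e i))) c

/-! ### The affine group, its representation and the Weyl operators -/

/-- The measure `dr / r` on `(0, ∞)`. -/
noncomputable def mulHaar : Measure ℝ :=
  (volume.restrict (Ioi 0)).withDensity fun r => ENNReal.ofReal r⁻¹

/-- The Hilbert space `𝒦 = L²((0, ∞), dr / r)`. -/
abbrev KSpace : Type := Lp ℂ 2 mulHaar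

theorem measurePreserving_dilation (a : ℝ) (ha : 0 < a) :
    MeasurePreserving (fun r : ℝ => a * r) mulHaar mulHaar := by
  have hm : Measurable fun r : ℝ => a * r := measurable_const_mul a
  refine ⟨hm, ?_⟩
  ext s hs
  rw [Measure.map_apply hm hs]
  have key : ∀ t : Set ℝ, MeasurableSet t → mulHaar t =
      ∫⁻ r, (Ioi (0 : ℝ) ∩ t).indicator (fun r => ENNReal.ofReal r⁻¹) r := by
    intro t ht
    rw [mulHaar, withDensity_apply _ ht, Measure.restrict_restrict ht,
      lintegral_indicator (measurableSet_Ioi.inter ht), Set.inter_comm]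
  rw [key _ (hm hs), key _ hs]
  have hF : Measurable ((Ioi (0 : ℝ) ∩ s).indicator fun r => ENNReal.ofReal r⁻¹) :=
    (by fun_prop : Measurable fun r : ℝ => ENNReal.ofReal r⁻¹).indicator (measurableSet_Ioi.inter hs)
  have h1 := lintegral_map (μ := (volume : Measure ℝ)) hF hm
  rw [Real.map_volume_mul_left ha.ne', lintegral_smul_measure] at h1
  have h2 : ∀ r : ℝ, (Ioi (0 : ℝ) ∩ (fun r => a * r) ⁻¹' s).indicator
      (fun r => ENNReal.ofReal r⁻¹) r =
      ENNReal.ofReal a * (Ioi (0 : ℝ) ∩ s).indicator (fun r => ENNReal.ofReal r⁻¹) (a * r) := by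
    intro r
    by_cases hr : r ∈ Ioi (0 : ℝ) ∩ (fun r => a * r) ⁻¹' s
    · have hr' : a * r ∈ Ioi (0 : ℝ) ∩ s := ⟨mul_pos ha hr.1, hr.2⟩
      rw [indicator_of_mem hr, indicator_of_mem hr', ← ENNReal.ofReal_mul ha.le]
      congr 1
      have : r ≠ 0 := ne_of_gt hr.1
      field_simp
    · have hr' : a * r ∉ Ioi (0 : ℝ) ∩ s := fun h =>
        hr ⟨(mul_pos_iff_of_pos_left ha).1 h.1, h.2⟩
      rw [indicator_of_notMem hr, indicator_of_notMem hr', mul_zero]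
  simp_rw [h2]
  have h3 : Measurable fun r : ℝ =>
      (Ioi (0 : ℝ) ∩ s).indicator (fun r => ENNReal.ofReal r⁻¹) (a * r) := hF.comp hm
  rw [lintegral_const_mul _ h3, ← h1, smul_eq_mul, ← mul_assoc,
    ← ENNReal.ofReal_mul ha.le, abs_of_pos (inv_pos.2 ha), mul_inv_cancel₀ ha.ne']
  simp

theorem measurable_phase (b : ℝ) :
    Measurable fun r : ℝ => Complex.exp (2 * Real.pi * Complex.I * b * r) := by fun_prop

theorem norm_phase (b r : ℝ) : ‖Complex.exp (2 * Real.pi * Complex.I * b * r)‖ = 1 := by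
  have : (2 * Real.pi * Complex.I * b * r : ℂ) = ((2 * Real.pi * b * r : ℝ) : ℂ) * Complex.I := by
    push_cast; ring
  rw [this, Complex.norm_exp_ofReal_mul_I]

theorem memLp_phase (b : ℝ) (ψ : KSpace) :
    MemLp (fun r : ℝ => Complex.exp (2 * Real.pi * Complex.I * b * r) * ψ r) 2 mulHaar :=
  (Lp.memLp ψ).of_le ((measurable_phase b).aestronglyMeasurable.mul (Lp.aestronglyMeasurable ψ))
    (Filter.Eventually.of_forall fun r => by rw [norm_mul, norm_phase, one_mul])

/-- Multiplication by the function `r ↦ exp(2πi b r)` on `𝒦`. -/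
noncomputable def phaseOp (b : ℝ) : KSpace →ₗᵢ[ℂ] KSpace where
  toFun ψ := (memLp_phase b ψ).toLp
  map_add' φ ψ := by
    ext1
    filter_upwards [(memLp_phase b (φ + ψ)).coeFn_toLp, (memLp_phase b φ).coeFn_toLp,
      (memLp_phase b ψ).coeFn_toLp, Lp.coeFn_add φ ψ,
      Lp.coeFn_add (memLp_phase b φ).toLp (memLp_phase b ψ).toLp] with r h1 h2 h3 h4 h5
    rw [h1, h5, Pi.add_apply, h2, h3, h4, Pi.add_apply, mul_add]
  map_smul' c ψ := by
    ext1
    filter_upwards [(memLp_phase b (c • ψ)).coeFn_toLp, (memLp_phase b ψ).coeFn_toLp,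
      Lp.coeFn_smul c ψ, Lp.coeFn_smul c (memLp_phase b ψ).toLp] with r h1 h2 h3 h4
    rw [h1, RingHom.id_apply, h4, Pi.smul_apply, h2, h3, Pi.smul_apply, smul_eq_mul, smul_eq_mul]
    ring
  norm_map' ψ := by
    change ‖(memLp_phase b ψ).toLp‖ = ‖ψ‖
    rw [Lp.norm_toLp, Lp.norm_def]
    congr 1
    exact eLpNorm_congr_norm_ae
      (Filter.Eventually.of_forall fun r => by rw [norm_mul, norm_phase, one_mul])

/-- The irreducible representation of the group of affine maps `t ↦ a t + b`, `a > 0`, on `𝒦`: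
`U(a, b) ψ(r) = exp(2πi b r) ψ(a r)`. -/
noncomputable def affineRep (a b : ℝ) (ha : 0 < a) : KSpace →ₗᵢ[ℂ] KSpace :=
  (phaseOp b).comp
    (Lp.compMeasurePreservingₗᵢ ℂ (fun r : ℝ => a * r) (measurePreserving_dilation a ha))

theorem affineRep_coeFn (a b : ℝ) (ha : 0 < a) (ψ : KSpace) :
    affineRep a b ha ψ =ᵐ[mulHaar]
      fun r => Complex.exp (2 * Real.pi * Complex.I * b * r) * ψ (a * r) := by
  have h := Lp.coeFn_compMeasurePreserving ψ (measurePreserving_dilation a ha)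
  filter_upwards [(memLp_phase b (Lp.compMeasurePreserving (fun r : ℝ => a * r)
    (measurePreserving_dilation a ha) ψ)).coeFn_toLp, h] with r h1 h2
  refine h1.trans ?_
  rw [h2, Function.comp_apply]

/-- The function `λ(t) = t / (1 - exp(-t))`, `λ(0) = 1`. -/
noncomputable def lam (t : ℝ) : ℝ := if t = 0 then 1 else t / (1 - Real.exp (-t))

/-- The Weyl operator `W(u, v) = U(exp(u X₁ + v X₂)) = U(eᵘ, v eᵘ / λ(u))`. -/
noncomputable def weylOp (u v : ℝ) : KSpace →ₗᵢ[ℂ] KSpace :=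
  affineRep (Real.exp u) (v * Real.exp u / lam u) (Real.exp_pos u)

/-! ### The quantizer -/

/-- The half-plane `Π = {(x, y) : y > 0}`; the point `z = x + i y` is written `(x, y)`. -/
def halfPlane : TopologicalSpace.Opens (ℝ × ℝ) :=
  ⟨{z | 0 < z.2}, isOpen_lt continuous_const continuous_snd⟩

/-- The open half-line `(0, ∞)`. -/
def halfLine : TopologicalSpace.Opens ℝ := ⟨Ioi 0, isOpen_Ioi⟩

/-- The measure `dω(z) = dx dy / y` on `Π`. -/
noncomputable def omegaMeasure : Measure (ℝ × ℝ) :=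
  (volume.restrict (halfPlane : Set (ℝ × ℝ))).withDensity fun z => ENNReal.ofReal z.2⁻¹

/-- The elements of `𝒦` that are test functions on `(0, ∞)`. -/
def IsTestVector (ψ : KSpace) : Prop := ∃ g : 𝓓(halfLine, ℂ), ψ =ᵐ[mulHaar] g

/-- The integrand `exp(-2πi (u x + v y)) ⟨φ, W(u, v) ψ⟩` at `p = (u, v)`, `z = (x, y)`. -/
noncomputable def quantizerIntegrand (z : ℝ × ℝ) (φ ψ : KSpace) (p : ℝ × ℝ) : ℂ :=
  Complex.exp (-(2 * Real.pi * Complex.I * (p.1 * z.1 + p.2 * z.2))) *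
    inner ℂ φ (weylOp p.1 p.2 ψ)

/-- The matrix elements `⟨φ, Ω(z) ψ⟩` of the quantizer
`Ω(z) = |y| ∬ exp(-2πi (u x + v y)) W(u, v) du dv`; the operator-valued integral is a weak one,
to be used with test functions `φ`, `ψ` on `(0, ∞)`. -/
noncomputable def quantizer (z : ℝ × ℝ) (φ ψ : KSpace) : ℂ :=
  |z.2| * ∫ p : ℝ × ℝ, quantizerIntegrand z φ ψ p

/-- The bounded operator `A` is the (weak) integral `∫ Ω(z) f(z) dω(z)`. -/
def IsQuantization (f : ℝ × ℝ → ℂ) (A : KSpace →L[ℂ] KSpace) : Prop :=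
  ∀ φ ψ : KSpace, IsTestVector φ → IsTestVector ψ →
    Integrable (fun z => quantizer z φ ψ * f z) omegaMeasure ∧
    inner ℂ φ (A ψ) = ∫ z, quantizer z φ ψ * f z ∂omegaMeasure

/-- The function `F` on `Π` is the distribution `z ↦ Tr(Ω(z) A)`, that is,
`∫ f(z) F(z) dω(z) = Tr((∫ f(z) Ω(z) dω(z)) A)` for all test functions `f` on `Π`. -/
def IsDequantization (A : KSpace →L[ℂ] KSpace) (F : ℝ × ℝ → ℂ) : Prop :=
  ∀ f : 𝓓(halfPlane, ℂ), ∃ B : KSpace →L[ℂ] KSpace, IsQuantization f B ∧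
    HasTrace (B ∘L A) (∫ z, f z * F z ∂omegaMeasure)

/-!
The quantizer is a composition of three unitary operators, which turn the operator `|φ⟩⟨ψ|` into the
function `z ↦ conj ⟨φ, Ω(z) ψ⟩`.

For test functions `φ`, `ψ` the matrix element `⟨φ, W(u, v) ψ⟩` is the inverse Fourier transform of
`r ↦ conj (φ r) ψ(eᵘ r) / r` at `v / λ(-u)` (`inner_weylOp_testVector`). It vanishes for large `u`
and decreases like `v⁻²` in `v`, uniformly in `u`, so the integral over `(u, v)` converges
absolutely. Fourier inversion in `v` and the identity `λ(u) = eᵘ λ(-u)` give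
`⟨φ, Ω(x + i y) ψ⟩ = ∫ exp(-2πi u x) conj (φ (y λ(-u))) ψ (y λ(u)) du` (`quantizer_testVector`).

The map `(u, y) ↦ (y λ(-u), y λ(u))` is a shear in logarithmic coordinates, because
`log λ(u) - log λ(-u) = u`. So it carries `du dy/y` to `ds/s dr/r` (`measurePreserving_pairMap`).
Hence `|φ⟩⟨ψ| ↦ φ ⊗ conj ψ`, the composition with this map and the partial Fourier transform from
`u` to `x` are unitary operators from the Hilbert–Schmidt operators to `L²(ds/s dr/r)`,
`L²(du dy/y)` and `L²(dx dy/y) = L²(Π, dω)`. Their composition is the dequantization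
(`exists_dequantization`), and its inverse is the quantization, since
`⟨φ, A ψ⟩ = ⟨|φ⟩⟨ψ|, A⟩ = ∫ ⟨φ, Ω(z) ψ⟩ f(z) dω(z)` when `A` is the inverse image of `f`
(`isQuantization_dequantization_symm`).

The first and the third of these operators are obtained from their values on a total family, on
which only Gram matrices have to be compared (`IsTotalFamily.exists_linearIsometryEquiv`). That the
partial Fourier transform, defined in this way on tensor products, is given by the Fourier integral
on `L¹ ∩ L²` follows by integration over rectangles (`partialFourierInv_coeFn`).

The substitution `u ↦ -u` shows that the dequantization intertwines the adjoint with complex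
conjugation (`dequantization_adj`). With `Tr(A B) = ⟨A†, B⟩` this yields the trace formulas.
-/

/-! ### Unitary operators from Gram matrices -/

/-- A family of vectors in a Hilbert space is total when only `0` is orthogonal to all of it. -/
def IsTotalFamily {ι : Type*} {H : Type*} [NormedAddCommGroup H] [InnerProductSpace ℂ H]
    (x : ι → H) : Prop :=
  ∀ v : H, (∀ i, inner ℂ (x i) v = 0) → v = 0

namespace IsTotalFamily

variable {ι : Type*} {H : Type*} [NormedAddCommGroup H] [InnerProductSpace ℂ H]

theorem dense_span [CompleteSpace H] {x : ι → H} (hx : IsTotalFamily x) :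
    (Submodule.span ℂ (range x)).topologicalClosure = ⊤ := by
  rw [Submodule.topologicalClosure_eq_top_iff, Submodule.eq_bot_iff]
  intro v hv
  refine hx v fun i => ?_
  exact (Submodule.mem_orthogonal _ _).1 hv _ (Submodule.subset_span ⟨i, rfl⟩)

theorem denseRange_linearCombination [CompleteSpace H] {x : ι → H} (hx : IsTotalFamily x) :
    DenseRange (Finsupp.linearCombination ℂ x) := by
  have h := hx.dense_span
  rw [← Submodule.dense_iff_topologicalClosure_eq_top] at h
  rw [DenseRange, ← LinearMap.coe_range, Finsupp.range_linearCombination]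
  exact h

/-- Two total families with the same Gram matrix differ by a unitary operator. -/
theorem exists_linearIsometryEquiv [CompleteSpace H] {H' : Type*} [NormedAddCommGroup H']
    [InnerProductSpace ℂ H'] [CompleteSpace H'] {x : ι → H} {y : ι → H'}
    (hx : IsTotalFamily x) (hy : IsTotalFamily y)
    (h : ∀ i j, inner ℂ (y i) (y j) = inner ℂ (x i) (x j)) :
    ∃ U : H ≃ₗᵢ[ℂ] H', ∀ i, U (x i) = y i := by
  have hn : ∀ c : ι →₀ ℂ, ‖Finsupp.linearCombination ℂ y (LinearEquiv.refl ℂ (ι →₀ ℂ) c)‖ =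
      ‖Finsupp.linearCombination ℂ x c‖ := by
    intro c
    -- the square of either norm is the same quadratic form in the coefficients `c`
    rw [LinearEquiv.refl_apply, @norm_eq_sqrt_re_inner ℂ, @norm_eq_sqrt_re_inner ℂ]
    congr 2
    simp only [Finsupp.linearCombination_apply, Finsupp.sum, sum_inner, inner_sum,
      inner_smul_left, inner_smul_right, h]
  refine ⟨(LinearEquiv.refl ℂ (ι →₀ ℂ)).extendOfIsometry _ _ hx.denseRange_linearCombination
    hy.denseRange_linearCombination hn, fun i => ?_⟩
  have h1 := (LinearEquiv.refl ℂ (ι →₀ ℂ)).extendOfIsometry_eq (Finsupp.linearCombination ℂ x)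
    (Finsupp.linearCombination ℂ y) hx.denseRange_linearCombination
    hy.denseRange_linearCombination hn (Finsupp.single i 1)
  simpa using h1

/-- The twist `σ` of the scalars is the identity or complex conjugation in the applications. -/
theorem eq_of_semilinear [CompleteSpace H] {H' : Type*} [NormedAddCommGroup H']
    [InnerProductSpace ℂ H'] {σ : ℂ →+* ℂ} {x : ι → H} (hx : IsTotalFamily x)
    (S T : H →SL[σ] H') (h : ∀ i, S (x i) = T (x i)) : S = T := by
  refine ContinuousLinearMap.ext_on (s := range x) ?_ ?_
  · rw [Submodule.dense_iff_topologicalClosure_eq_top]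
    exact hx.dense_span
  · rintro _ ⟨i, rfl⟩
    exact h i

end IsTotalFamily

/-! ### Hilbert–Schmidt operators -/

section HilbertBasisSums

variable {H : Type*} [NormedAddCommGroup H] [InnerProductSpace ℂ H] {ι κ : Type*}

theorem HilbertBasis.hasSum_norm_inner_sq (e : HilbertBasis ι ℂ H) (v : H) :
    HasSum (fun i => ‖inner ℂ (e i) v‖ ^ 2) (‖v‖ ^ 2) := by
  have h := e.hasSum_inner_mul_inner v v
  have h2 := Complex.hasSum_re h
  have h3 : (inner ℂ v v : ℂ).re = ‖v‖ ^ 2 := by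
    rw [inner_self_eq_norm_sq_to_K]; norm_cast
  rw [h3] at h2
  refine h2.congr_fun fun i => ?_
  rw [← inner_conj_symm, RCLike.norm_conj, Complex.mul_conj,
    Complex.ofReal_re, Complex.normSq_eq_norm_sq]

theorem HilbertBasis.tsum_enorm_inner_sq (e : HilbertBasis ι ℂ H) (v : H) :
    ∑' i, ‖inner ℂ (e i) v‖ₑ ^ 2 = ‖v‖ₑ ^ 2 := by
  have h := e.hasSum_norm_inner_sq v
  have h1 := ENNReal.ofReal_tsum_of_nonneg (fun i => by positivity) h.summable
  rw [h.tsum_eq] at h1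
  simp_rw [ENNReal.ofReal_pow (norm_nonneg _), ofReal_norm] at h1
  exact h1.symm

variable [CompleteSpace H]

/-- Both sides are the sum of the squared matrix elements `|⟨fⱼ, A eᵢ⟩|²`. -/
theorem HilbertBasis.tsum_enorm_sq_eq_adjoint (e : HilbertBasis ι ℂ H) (f : HilbertBasis κ ℂ H)
    (A : H →L[ℂ] H) :
    ∑' i, ‖A (e i)‖ₑ ^ 2 = ∑' j, ‖ContinuousLinearMap.adjoint A (f j)‖ₑ ^ 2 := by
  simp_rw [← f.tsum_enorm_inner_sq (A _), ← e.tsum_enorm_inner_sq (ContinuousLinearMap.adjoint A _)]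
  rw [ENNReal.tsum_comm]
  refine tsum_congr fun j => tsum_congr fun i => ?_
  rw [ContinuousLinearMap.adjoint_inner_right, ← inner_conj_symm, RCLike.enorm_conj]

theorem HilbertBasis.tsum_enorm_sq_eq (e : HilbertBasis ι ℂ H) (f : HilbertBasis κ ℂ H)
    (A : H →L[ℂ] H) : ∑' i, ‖A (e i)‖ₑ ^ 2 = ∑' j, ‖A (f j)‖ₑ ^ 2 :=
  (e.tsum_enorm_sq_eq_adjoint f A).trans (f.tsum_enorm_sq_eq_adjoint f A).symm

end HilbertBasisSums

theorem summable_norm_sq_iff_tsum_enorm {ι E : Type*} [NormedAddCommGroup E] (g : ι → E) :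
    Summable (fun i => ‖g i‖ ^ 2) ↔ ∑' i, ‖g i‖ₑ ^ 2 ≠ ⊤ := by
  have h : ∀ i, ‖g i‖ₑ ^ 2 = ((‖g i‖₊ ^ 2 : NNReal) : ℝ≥0∞) := fun i => by
    rw [enorm_eq_nnnorm]; push_cast; rfl
  simp_rw [h]
  rw [ENNReal.tsum_coe_ne_top_iff_summable, ← NNReal.summable_coe]
  simp

theorem tsum_norm_sq_eq_toReal {ι E : Type*} [NormedAddCommGroup E] (g : ι → E) :
    ∑' i, ‖g i‖ ^ 2 = (∑' i, ‖g i‖ₑ ^ 2).toReal := by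
  rw [ENNReal.tsum_toReal_eq fun i => by simp]
  simp

section HS

variable {H : Type u} [NormedAddCommGroup H] [InnerProductSpace ℂ H]

theorem rankOne_mem_hsSubmodule (φ ψ : H) :
    InnerProductSpace.rankOne ℂ φ ψ ∈ hsSubmodule H := by
  intro κ f
  refine ((f.hasSum_norm_inner_sq ψ).summable.mul_right (‖φ‖ ^ 2)).congr fun i => ?_
  rw [InnerProductSpace.rankOne_apply, norm_smul, mul_pow, norm_inner_symm]

namespace HilbertSchmidt

/-- The operator `v ↦ ⟨ψ, v⟩ φ` as a Hilbert–Schmidt operator. -/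
noncomputable def ketBra (φ ψ : H) : HilbertSchmidt H :=
  (⟨InnerProductSpace.rankOne ℂ φ ψ, rankOne_mem_hsSubmodule φ ψ⟩ : hsSubmodule H)

theorem toOp_ketBra (φ ψ : H) : toOp (ketBra φ ψ) = InnerProductSpace.rankOne ℂ φ ψ := rfl

end HilbertSchmidt

variable [CompleteSpace H]

theorem mem_hsSubmodule_of_summable {ι : Type*} (e : HilbertBasis ι ℂ H) {A : H →L[ℂ] H}
    (h : Summable fun i => ‖A (e i)‖ ^ 2) : A ∈ hsSubmodule H := by
  intro κ f
  rw [summable_norm_sq_iff_tsum_enorm] at h ⊢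
  rwa [← e.tsum_enorm_sq_eq f]

theorem adjoint_mem_hsSubmodule {A : H →L[ℂ] H} (h : A ∈ hsSubmodule H) :
    ContinuousLinearMap.adjoint A ∈ hsSubmodule H := by
  intro κ f
  have h1 := h κ f
  rw [summable_norm_sq_iff_tsum_enorm] at h1 ⊢
  rwa [← f.tsum_enorm_sq_eq_adjoint f]

namespace HilbertSchmidt

/-- The norm is defined by one particular basis, but any basis computes it. -/
theorem norm_sq_eq {ι : Type*} (A : HilbertSchmidt H) (e : HilbertBasis ι ℂ H) :
    ‖A‖ ^ 2 = ∑' i, ‖toOp A (e i)‖ ^ 2 := by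
  have h : (inner ℂ A A : ℂ) = ∑' i, inner ℂ (toOp A (basis H i)) (toOp A (basis H i)) := rfl
  have h2 : (inner ℂ A A : ℂ) = ((∑' i, ‖toOp A (basis H i)‖ ^ 2 : ℝ) : ℂ) := by
    rw [h, Complex.ofReal_tsum]
    exact tsum_congr fun i => by rw [inner_self_eq_norm_sq_to_K]; norm_cast
  rw [inner_self_eq_norm_sq_to_K] at h2
  have h3 : ‖A‖ ^ 2 = ∑' i, ‖toOp A (basis H i)‖ ^ 2 := by
    apply Complex.ofReal_injective
    rw [← h2]; norm_cast
  rw [h3, tsum_norm_sq_eq_toReal, tsum_norm_sq_eq_toReal, (basis H).tsum_enorm_sq_eq e]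

/-- The sequence `(A eᵢ)` of the columns of a Hilbert–Schmidt operator `A`, in the Hilbert sum of
copies of `H`. -/
noncomputable def columns {ι : Type u} (e : HilbertBasis ι ℂ H) :
    HilbertSchmidt H →ₗᵢ[ℂ] lp (fun _ : ι => H) 2 where
  toFun A := ⟨fun i => toOp A (e i), by
    refine (memℓp_gen_iff (by norm_num)).2 ?_
    simpa using A.summable_sq e⟩
  map_add' A B := by ext i; simp; rfl
  map_smul' c A := by ext i; simp
  norm_map' A := by
    refine (sq_eq_sq₀ (norm_nonneg _) (norm_nonneg _)).1 ?_
    rw [A.norm_sq_eq e]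
    have h := lp.norm_rpow_eq_tsum (p := 2) (by norm_num)
      (⟨fun i => toOp A (e i), by
        refine (memℓp_gen_iff (by norm_num)).2 ?_
        simpa using A.summable_sq e⟩ : lp (fun _ : ι => H) 2)
    simpa using h

theorem hasSum_inner {ι : Type u} (A B : HilbertSchmidt H) (e : HilbertBasis ι ℂ H) :
    HasSum (fun i => inner ℂ (toOp A (e i)) (toOp B (e i))) (inner ℂ A B) := by
  rw [← (columns e).inner_map_map]
  exact lp.hasSum_inner (columns e A) (columns e B)

/-- Every square summable sequence `(xᵢ)` is the sequence of columns of the operator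
`v ↦ ∑ ⟨eᵢ, v⟩ xᵢ`. -/
theorem columns_surjective {ι : Type u} (e : HilbertBasis ι ℂ H) :
    Function.Surjective (columns e) := by
  intro x
  have hx : Summable fun i => ‖x i‖ ^ (2 : ℝ) := by
    have := (memℓp_gen_iff (p := 2) (by norm_num)).1 x.2
    simpa using this
  have hv : ∀ v : H, Summable fun i => ‖inner ℂ (e i) v‖ ^ (2 : ℝ) := fun v => by
    simpa using (e.hasSum_norm_inner_sq v).summable
  have hs : ∀ v : H, Summable fun i => ‖inner ℂ (e i) v‖ * ‖x i‖ := fun v =>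
    Real.summable_mul_of_Lp_Lq_of_nonneg Real.HolderConjugate.two_two
      (fun i => norm_nonneg _) (fun i => norm_nonneg _) (hv v) hx
  have hs' : ∀ v : H, Summable fun i => (inner ℂ (e i) v : ℂ) • x i := fun v => by
    refine Summable.of_norm ?_
    simpa only [norm_smul] using hs v
  let L : H →ₗ[ℂ] H :=
    { toFun := fun v => ∑' i, (inner ℂ (e i) v : ℂ) • x i
      map_add' := fun v w => by
        rw [← (hs' v).tsum_add (hs' w)]
        exact tsum_congr fun i => by rw [inner_add_right, add_smul]
      map_smul' := fun c v => by
        rw [RingHom.id_apply, ← (hs' v).tsum_const_smul]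
        exact tsum_congr fun i => by rw [inner_smul_right, smul_smul] }
  let A : H →L[ℂ] H := L.mkContinuous ((∑' i, ‖x i‖ ^ (2 : ℝ)) ^ (1 / 2 : ℝ)) (by
    intro v
    -- the Cauchy–Schwarz inequality, with Parseval's identity for the coefficients of `v`
    refine (norm_tsum_le_tsum_norm (by simpa only [norm_smul] using hs v)).trans ?_
    simp_rw [norm_smul]
    refine (Real.inner_le_Lp_mul_Lq_tsum_of_nonneg Real.HolderConjugate.two_two
      (fun i => norm_nonneg _) (fun i => norm_nonneg _) (hv v) hx).trans ?_
    have h1 : ∑' i, ‖inner ℂ (e i) v‖ ^ (2 : ℝ) = ‖v‖ ^ (2 : ℝ) := by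
      simpa using (e.hasSum_norm_inner_sq v).tsum_eq
    rw [h1, ← Real.rpow_mul (norm_nonneg _), mul_comm]
    norm_num)
  have hA : ∀ i, A (e i) = x i := by
    intro i
    change ∑' j, (inner ℂ (e j) (e i) : ℂ) • x j = x i
    rw [tsum_eq_single i]
    · simp [e.orthonormal.1 i]
    · intro j hj
      rw [e.orthonormal.2 hj, zero_smul]
  have hm : A ∈ hsSubmodule H := by
    refine mem_hsSubmodule_of_summable e ?_
    simpa [hA] using hx
  refine ⟨(⟨A, hm⟩ : hsSubmodule H), ?_⟩
  ext i
  exact hA i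

/-- The columns identify the Hilbert–Schmidt operators with a complete Hilbert sum. -/
instance : CompleteSpace (HilbertSchmidt H) :=
  (LinearIsometryEquiv.ofSurjective (columns (basis H))
    (columns_surjective (basis H))).toIsometryEquiv.completeSpace

/-- The adjoint, as an antilinear isometry of the space of Hilbert–Schmidt operators. -/
noncomputable def adj : HilbertSchmidt H →ₗᵢ⋆[ℂ] HilbertSchmidt H where
  toFun A := (⟨ContinuousLinearMap.adjoint (toOp A), adjoint_mem_hsSubmodule A.2⟩ : hsSubmodule H)
  map_add' A B := by
    apply toOp_injective
    exact map_add ContinuousLinearMap.adjoint (toOp A) (toOp B)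
  map_smul' c A := by
    apply toOp_injective
    exact map_smulₛₗ ContinuousLinearMap.adjoint c (toOp A)
  norm_map' A := by
    refine (sq_eq_sq₀ (norm_nonneg _) (norm_nonneg _)).1 ?_
    rw [norm_sq_eq _ (basis H), norm_sq_eq A (basis H), tsum_norm_sq_eq_toReal,
      tsum_norm_sq_eq_toReal, (basis H).tsum_enorm_sq_eq_adjoint (basis H) (toOp A)]
    rfl

theorem toOp_adj (A : HilbertSchmidt H) : toOp (adj A) = ContinuousLinearMap.adjoint (toOp A) :=
  rfl

/-- This is `Tr (A B) = ⟨A†, B⟩`, where the inner product may be computed in any basis. -/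
theorem hasTrace_comp (A B : HilbertSchmidt H) :
    HasTrace (toOp A ∘L toOp B) (inner ℂ (adj A) B) := by
  intro ι e
  refine (hasSum_inner (adj A) B e).congr_fun fun i => ?_
  rw [toOp_adj, ContinuousLinearMap.adjoint_inner_left, ContinuousLinearMap.comp_apply]

theorem inner_ketBra (φ ψ : H) (A : HilbertSchmidt H) :
    inner ℂ (ketBra φ ψ) A = inner ℂ φ (toOp A ψ) := by
  have h1 := (hasSum_inner (ketBra φ ψ) A (basis H)).tsum_eq
  rw [← h1, ← ContinuousLinearMap.adjoint_inner_left,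
    ← (basis H).tsum_inner_mul_inner (ContinuousLinearMap.adjoint (toOp A) φ) ψ]
  refine tsum_congr fun i => ?_
  rw [toOp_ketBra, InnerProductSpace.rankOne_apply, inner_smul_left, inner_conj_symm,
    ContinuousLinearMap.adjoint_inner_left, mul_comm]

theorem inner_ketBra_ketBra (φ ψ φ' ψ' : H) :
    inner ℂ (ketBra φ ψ) (ketBra φ' ψ') = inner ℂ φ φ' * inner ℂ ψ' ψ := by
  rw [inner_ketBra, toOp_ketBra, InnerProductSpace.rankOne_apply, inner_smul_right, mul_comm]

theorem adj_ketBra (φ ψ : H) : adj (ketBra φ ψ) = ketBra ψ φ := by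
  apply toOp_injective
  rw [toOp_adj, toOp_ketBra, toOp_ketBra, InnerProductSpace.adjoint_rankOne]

theorem isTotalFamily_ketBra :
    IsTotalFamily fun p : H × H => ketBra p.1 p.2 := by
  intro A hA
  apply toOp_injective
  ext ψ
  refine ext_inner_left ℂ fun φ => ?_
  rw [← inner_ketBra φ ψ A, hA (φ, ψ), map_zero]
  simp

end HilbertSchmidt

end HS

/-! ### Tensor products of square integrable functions -/

section Rectangles

variable {α β : Type*} [MeasurableSpace α] [MeasurableSpace β] {μ : Measure α} {ν : Measure β}

theorem memLp_two_mul_prod [SFinite μ] [SFinite ν] {a : α → ℂ} {b : β → ℂ} (ha : MemLp a 2 μ)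
    (hb : MemLp b 2 ν) :
    MemLp (fun p : α × β => a p.1 * b p.2) 2 (μ.prod ν) := by
  rw [memLp_two_iff_integrable_sq_norm (ha.1.comp_fst.fun_mul hb.1.comp_snd)]
  refine ((ha.integrable_norm_pow two_ne_zero).mul_prod (hb.integrable_norm_pow two_ne_zero)).congr
    (Filter.Eventually.of_forall fun p => ?_)
  simp [mul_pow]

variable [SigmaFinite μ] [SigmaFinite ν]

/-- A function on a product space vanishes almost everywhere when its integrals over all
rectangles of finite measure exist and vanish. -/
theorem ae_eq_zero_of_setIntegral_prod_eq_zero {d : α × β → ℂ}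
    (hi : ∀ A B, MeasurableSet A → MeasurableSet B → μ A < ⊤ → ν B < ⊤ →
      IntegrableOn d (A ×ˢ B) (μ.prod ν))
    (h0 : ∀ A B, MeasurableSet A → MeasurableSet B → μ A < ⊤ → ν B < ⊤ →
      ∫ p in A ×ˢ B, d p ∂μ.prod ν = 0) :
    d =ᵐ[μ.prod ν] 0 := by
  have key : ∀ n, d =ᵐ[(μ.prod ν).restrict (spanningSets μ n ×ˢ spanningSets ν n)] 0 := by
    intro n
    have hmA := measurableSet_spanningSets μ n
    have hmB := measurableSet_spanningSets ν n
    have hfA := measure_spanningSets_lt_top μ n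
    have hfB := measure_spanningSets_lt_top ν n
    have hint := hi _ _ hmA hmB hfA hfB
    -- on a rectangle of finite measure, Dynkin's π-λ theorem passes to all measurable sets
    refine Integrable.ae_eq_zero_of_forall_setIntegral_eq_zero hint fun s hs _ => ?_
    clear * - hs hint h0 hmA hmB hfA hfB
    induction s, hs using MeasurableSpace.induction_on_inter generateFrom_prod.symm
      isPiSystem_prod with
    | empty => simp
    | basic t ht =>
      obtain ⟨A, hA, B, hB, rfl⟩ := ht
      rw [Measure.restrict_restrict (hA.prod hB), prod_inter_prod]
      exact h0 _ _ (hA.inter hmA) (hB.inter hmB)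
        ((measure_mono inter_subset_right).trans_lt hfA)
        ((measure_mono inter_subset_right).trans_lt hfB)
    | compl t ht ih =>
      have h1 := integral_add_compl ht hint
      rw [ih, zero_add, h0 _ _ hmA hmB hfA hfB] at h1
      exact h1
    | iUnion f hd hf ih =>
      rw [integral_iUnion hf hd hint.integrableOn]
      simp [ih]
  have h2 : (⋃ n, spanningSets μ n ×ˢ spanningSets ν n) = univ := by
    rw [eq_univ_iff_forall]
    rintro ⟨a, b⟩
    refine mem_iUnion.2 ⟨max (spanningSetsIndex μ a) (spanningSetsIndex ν b), ?_, ?_⟩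
    · exact monotone_spanningSets μ (le_max_left _ _) (mem_spanningSetsIndex μ a)
    · exact monotone_spanningSets ν (le_max_right _ _) (mem_spanningSetsIndex ν b)
  rw [← Measure.restrict_univ (μ := μ.prod ν), ← h2]
  exact ae_restrict_iUnion_iff _ _ |>.2 key

/-- The tensor product `(x, y) ↦ a x * b y` of two square integrable functions. -/
noncomputable def Lp.tensor (a : Lp ℂ 2 μ) (b : Lp ℂ 2 ν) : Lp ℂ 2 (μ.prod ν) :=
  (memLp_two_mul_prod (Lp.memLp a) (Lp.memLp b)).toLp

theorem Lp.coeFn_tensor (a : Lp ℂ 2 μ) (b : Lp ℂ 2 ν) :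
    Lp.tensor a b =ᵐ[μ.prod ν] fun p => a p.1 * b p.2 := MemLp.coeFn_toLp _

theorem Lp.inner_tensor (a a' : Lp ℂ 2 μ) (b b' : Lp ℂ 2 ν) :
    inner ℂ (Lp.tensor a b) (Lp.tensor a' b') = inner ℂ a a' * inner ℂ b b' := by
  rw [L2.inner_def, L2.inner_def, L2.inner_def, ← integral_prod_mul]
  refine integral_congr_ae ?_
  filter_upwards [Lp.coeFn_tensor a b, Lp.coeFn_tensor a' b'] with p h1 h2
  rw [h1, h2]
  simp only [RCLike.inner_apply, map_mul]
  ring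

theorem Lp.inner_tensor_indicator {A : Set α} {B : Set β} (hA : MeasurableSet A)
    (hB : MeasurableSet B) (hμ : μ A ≠ ⊤) (hν : ν B ≠ ⊤) (v : Lp ℂ 2 (μ.prod ν)) :
    inner ℂ (Lp.tensor (indicatorConstLp 2 hA hμ (1 : ℂ)) (indicatorConstLp 2 hB hν (1 : ℂ))) v =
      ∫ p in A ×ˢ B, v p ∂μ.prod ν := by
  rw [L2.inner_def, ← integral_indicator (hA.prod hB)]
  refine integral_congr_ae ?_
  filter_upwards [Lp.coeFn_tensor (indicatorConstLp 2 hA hμ (1 : ℂ))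
    (indicatorConstLp 2 hB hν (1 : ℂ)),
    Measure.quasiMeasurePreserving_fst.ae_eq_comp
      (indicatorConstLp_coeFn (p := 2) (hs := hA) (hμs := hμ) (c := (1 : ℂ))),
    Measure.quasiMeasurePreserving_snd.ae_eq_comp
      (indicatorConstLp_coeFn (p := 2) (hs := hB) (hμs := hν) (c := (1 : ℂ)))] with p h1 h2 h3
  simp only [Function.comp_apply] at h2 h3
  rw [h1, h2, h3]
  by_cases hp1 : p.1 ∈ A <;> by_cases hp2 : p.2 ∈ B <;> simp [hp1, hp2, indicator, mem_prod]

theorem Lp.isTotalFamily_tensor :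
    IsTotalFamily fun p : Lp ℂ 2 μ × Lp ℂ 2 ν => Lp.tensor p.1 p.2 := by
  intro v hv
  rw [Lp.eq_zero_iff_ae_eq_zero]
  refine ae_eq_zero_of_setIntegral_prod_eq_zero ?_ ?_
  · intro A B hA hB hμ hν
    refine integrableOn_Lp_of_measure_ne_top v one_le_two ?_
    rw [Measure.prod_prod]
    exact ENNReal.mul_ne_top hμ.ne hν.ne
  · intro A B hA hB hμ hν
    rw [← Lp.inner_tensor_indicator hA hB hμ.ne hν.ne]
    exact hv (_, _)

end Rectangles

/-! ### The partial Fourier transform -/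

section Fourier

open FourierTransform

/-- On `L¹ ∩ L²` the Fourier transform of `L²` is given by the Fourier integral. -/
theorem Lp.fourier_coeFn (a : Lp ℂ 2 (volume : Measure ℝ)) (ha : Integrable a) :
    (𝓕 a : Lp ℂ 2 (volume : Measure ℝ)) =ᵐ[volume] 𝓕 (a : ℝ → ℂ) := by
  have hc : Continuous (𝓕 (a : ℝ → ℂ)) := 
    VectorFourier.fourierIntegral_continuous Real.continuous_fourierChar continuous_inner ha
  -- both sides have the same integrals against test functions, by the definition of the Fourier
  -- transform of tempered distributions and by Fubini's theorem respectively
  refine ae_eq_of_integral_contDiff_smul_eq ((Lp.memLp _).locallyIntegrable one_le_two)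
    hc.locallyIntegrable fun g hg hgc => ?_
  let G : SchwartzMap ℝ ℂ := HasCompactSupport.toSchwartzMap (f := fun x => (g x : ℂ))
    (hgc.comp_left Complex.ofReal_zero) (Complex.ofRealCLM.contDiff.comp hg)
  have h1 := congrArg (fun T => T G) (Lp.fourier_toTemperedDistribution_eq a)
  simp only [TemperedDistribution.fourier_apply, Lp.toTemperedDistribution_apply] at h1
  have h2 : ∫ x, 𝓕 (G : ℝ → ℂ) x • a x = ∫ x, G x • 𝓕 (a : ℝ → ℂ) x := by
    simpa using! VectorFourier.integral_fourierIntegral_smul_eq_flip (L := innerₗ ℝ)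
      Real.continuous_fourierChar continuous_inner G.integrable ha
  have h3 : ∀ x, G x = (g x : ℂ) := fun x => rfl
  rw [SchwartzMap.fourier_coe, h2] at h1
  simpa [h3] using h1.symm

variable {β : Type*} [MeasurableSpace β] (ν : Measure β) [SigmaFinite ν]

/-- The Fourier transform of the first factor changes neither the Gram matrix nor the totality of
the family of tensor products. -/
theorem exists_partialFourierInv :
    ∃ P : Lp ℂ 2 ((volume : Measure ℝ).prod ν) ≃ₗᵢ[ℂ] Lp ℂ 2 ((volume : Measure ℝ).prod ν),
      ∀ (a : Lp ℂ 2 (volume : Measure ℝ)) (b : Lp ℂ 2 ν),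
        P (Lp.tensor (𝓕 a) b) = Lp.tensor a b := by
  have hx : IsTotalFamily fun p : Lp ℂ 2 (volume : Measure ℝ) × Lp ℂ 2 ν =>
      Lp.tensor (𝓕 p.1) p.2 := by
    intro v hv
    refine Lp.isTotalFamily_tensor v fun p => ?_
    have := hv (𝓕⁻ p.1, p.2)
    simpa only [fourier_fourierInv_eq] using this
  obtain ⟨P, hP⟩ := hx.exists_linearIsometryEquiv Lp.isTotalFamily_tensor fun p q => by
    rw [Lp.inner_tensor, Lp.inner_tensor, Lp.inner_fourier_eq]
  exact ⟨P, fun a b => hP (a, b)⟩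

/-- The inverse Fourier transform in the first variable, as a unitary operator on
`L²(ℝ × β)`. It is determined by its values on tensor products. -/
noncomputable def partialFourierInv :
    Lp ℂ 2 ((volume : Measure ℝ).prod ν) ≃ₗᵢ[ℂ] Lp ℂ 2 ((volume : Measure ℝ).prod ν) :=
  (exists_partialFourierInv ν).choose

theorem partialFourierInv_tensor (a : Lp ℂ 2 (volume : Measure ℝ)) (b : Lp ℂ 2 ν) :
    partialFourierInv ν (Lp.tensor (𝓕 a) b) = Lp.tensor a b :=
  (exists_partialFourierInv ν).choose_spec a b

variable {ν}

theorem integrable_phase_mul {μ : Measure ℝ} [IsFiniteMeasure μ] {G : ℝ × β → ℂ}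
    (hG : Integrable G (volume.prod ν)) :
    Integrable (fun t : (ℝ × β) × ℝ =>
      Complex.exp (2 * Real.pi * Complex.I * t.2 * t.1.1) * G (t.2, t.1.2))
      ((μ.prod ν).prod volume) := by
  have h1 : Integrable (fun t : ℝ × (β × ℝ) => G (t.2.2, t.2.1)) (μ.prod (ν.prod volume)) :=
    hG.swap.comp_snd μ
  have h2 := (measurePreserving_prodAssoc μ ν (volume : Measure ℝ)).integrable_comp_of_integrable h1
  refine h2.bdd_mul (c := 1) (by fun_prop) (Filter.Eventually.of_forall fun t => ?_)
  exact (norm_phase _ _).le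

theorem integrable_partialFourierIntegral {μ : Measure ℝ} [IsFiniteMeasure μ] {G : ℝ × β → ℂ}
    (hG : Integrable G (volume.prod ν)) :
    Integrable (fun p : ℝ × β =>
      ∫ u : ℝ, Complex.exp (2 * Real.pi * Complex.I * u * p.1) * G (u, p.2)) (μ.prod ν) :=
  (integrable_phase_mul hG).integral_prod_left

/-- Fubini's theorem for the three variables `x`, `u` and `y`. -/
theorem integral_partialFourierIntegral {μ : Measure ℝ} [IsFiniteMeasure μ] {G : ℝ × β → ℂ}
    (hG : Integrable G (volume.prod ν)) :
    ∫ p : ℝ × β, (∫ u : ℝ, Complex.exp (2 * Real.pi * Complex.I * u * p.1) * G (u, p.2)) ∂μ.prod ν =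
      ∫ p : ℝ × β, (∫ x : ℝ, Complex.exp (2 * Real.pi * Complex.I * p.1 * x) ∂μ) * G p
        ∂volume.prod ν := by
  have hi := integrable_phase_mul (μ := μ) hG
  have ha := measurePreserving_prodAssoc μ ν (volume : Measure ℝ)
  rw [← integral_prod _ hi]
  have hi' : Integrable (fun s : ℝ × (β × ℝ) =>
      Complex.exp (2 * Real.pi * Complex.I * s.2.2 * s.1) * G (s.2.2, s.2.1))
      (μ.prod (ν.prod volume)) :=
    (ha.integrable_comp_emb MeasurableEquiv.prodAssoc.measurableEmbedding).1 hi
  have h1 := ha.integral_comp MeasurableEquiv.prodAssoc.measurableEmbedding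
    (fun s : ℝ × (β × ℝ) =>
      Complex.exp (2 * Real.pi * Complex.I * s.2.2 * s.1) * G (s.2.2, s.2.1))
  refine h1.trans ?_
  rw [integral_prod_symm _ hi', ← integral_prod_swap]
  refine integral_congr_ae (Filter.Eventually.of_forall fun w => ?_)
  simp only [Prod.fst_swap, Prod.snd_swap]
  rw [integral_mul_const]

/-- On `L¹ ∩ L²` the partial Fourier transform is given by the Fourier integral in the first
variable. -/
theorem partialFourierInv_coeFn {G : ℝ × β → ℂ} (h2 : MemLp G 2 (volume.prod ν))
    (h1 : Integrable G (volume.prod ν)) :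
    partialFourierInv ν h2.toLp =ᵐ[volume.prod ν]
      fun p => ∫ u : ℝ, Complex.exp (2 * Real.pi * Complex.I * u * p.1) * G (u, p.2) := by
  have hq : ∀ A B, MeasurableSet A → MeasurableSet B → volume A < ⊤ → ν B < ⊤ →
      IntegrableOn (fun p : ℝ × β =>
        ∫ u : ℝ, Complex.exp (2 * Real.pi * Complex.I * u * p.1) * G (u, p.2)) (A ×ˢ B)
        (volume.prod ν) := by
    intro A B hA hB hAf hBf
    have : IsFiniteMeasure (volume.restrict A) := ⟨by simpa using hAf⟩
    rw [IntegrableOn, ← Measure.prod_restrict]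
    refine integrable_partialFourierIntegral (ν := ν.restrict B) ?_
    rw [← Measure.restrict_univ (μ := (volume : Measure ℝ)), Measure.prod_restrict]
    exact h1.integrableOn
  have hP : ∀ A B, MeasurableSet A → MeasurableSet B → volume A < ⊤ → ν B < ⊤ →
      IntegrableOn (partialFourierInv ν h2.toLp) (A ×ˢ B) (volume.prod ν) := by
    intro A B hA hB hAf hBf
    refine integrableOn_Lp_of_measure_ne_top _ one_le_two ?_
    rw [Measure.prod_prod]
    exact ENNReal.mul_ne_top hAf.ne hBf.ne
  have h3 := ae_eq_zero_of_setIntegral_prod_eq_zero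
    (d := fun p => partialFourierInv ν h2.toLp p -
      ∫ u : ℝ, Complex.exp (2 * Real.pi * Complex.I * u * p.1) * G (u, p.2))
    (fun A B hA hB hAf hBf => (hP A B hA hB hAf hBf).sub (hq A B hA hB hAf hBf)) ?_
  · filter_upwards [h3] with p hp
    exact sub_eq_zero.1 hp
  intro A B hA hB hAf hBf
  have : IsFiniteMeasure (volume.restrict A) := ⟨by simpa using hAf⟩
  -- an integral over `A ×ˢ B` is an inner product with `1_A ⊗ 1_B`, which the unitary operator
  -- `partialFourierInv` moves to the inner product of `𝓕 1_A ⊗ 1_B` with `G`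
  rw [integral_sub (hP A B hA hB hAf hBf) (hq A B hA hB hAf hBf), sub_eq_zero,
    ← Lp.inner_tensor_indicator hA hB hAf.ne hBf.ne, ← partialFourierInv_tensor,
    LinearIsometryEquiv.inner_map_map, ← Measure.prod_restrict]
  have hr : (volume : Measure ℝ).prod (ν.restrict B) =
      ((volume : Measure ℝ).prod ν).restrict (univ ×ˢ B) := by
    rw [← Measure.prod_restrict, Measure.restrict_univ]
  have h4 : Integrable G (volume.prod (ν.restrict B)) := by
    rw [hr]
    exact h1.integrableOn
  rw [integral_partialFourierIntegral h4, L2.inner_def]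
  rw [hr, ← integral_indicator (MeasurableSet.univ.prod hB)]
  have hAi : Integrable (indicatorConstLp 2 hA hAf.ne (1 : ℂ)) :=
    ((integrable_indicator_iff hA).2 (integrableOn_const hAf.ne)).congr
      indicatorConstLp_coeFn.symm
  refine integral_congr_ae ?_
  filter_upwards [Lp.coeFn_tensor (𝓕 (indicatorConstLp 2 hA hAf.ne (1 : ℂ)))
      (indicatorConstLp 2 hB hBf.ne (1 : ℂ)),
    Measure.quasiMeasurePreserving_fst.ae_eq_comp (Lp.fourier_coeFn _ hAi),
    Measure.quasiMeasurePreserving_snd.ae_eq_comp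
      (indicatorConstLp_coeFn (p := 2) (hs := hB) (hμs := hBf.ne) (c := (1 : ℂ))),
    h2.coeFn_toLp] with p e1 e2 e3 e4
  simp only [Function.comp_apply] at e2 e3
  rw [e1, e2, e3, e4]
  have e5 : 𝓕 (indicatorConstLp 2 hA hAf.ne (1 : ℂ) : ℝ → ℂ) p.1 =
      ∫ x in A, Complex.exp (-(2 * Real.pi * Complex.I * p.1 * x)) := by
    rw [Real.fourier_congr_ae indicatorConstLp_coeFn, Real.fourier_real_eq_integral_exp_smul,
      ← integral_indicator hA]
    congr 1
    ext x
    by_cases hx : x ∈ A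
    · simp only [hx, indicator_of_mem, smul_eq_mul, mul_one]
      congr 1
      push_cast
      ring
    · simp [hx]
  rw [e5]
  by_cases hp : p.2 ∈ B
  · rw [indicator_of_mem hp, indicator_of_mem (mk_mem_prod (mem_univ _) hp), mul_one,
      RCLike.inner_apply, ← integral_conj, mul_comm]
    congr 2
    ext x
    rw [← Complex.exp_conj]
    simp [Complex.conj_ofNat]
  · rw [indicator_of_notMem hp, indicator_of_notMem (fun h => hp h.2), mul_zero, inner_zero_left]

end Fourier

/-! ### Test functions in weighted spaces -/

section

variable {E : Type*} [NormedAddCommGroup E] [NormedSpace ℝ E] {U : TopologicalSpace.Opens E}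

/-- The complex conjugate of a test function. -/
noncomputable def TestFunction.conj (g : 𝓓(U, ℂ)) : 𝓓(U, ℂ) where
  toFun x := (starRingEnd ℂ) (g x)
  contDiff' := Complex.conjCLE.contDiff.comp g.contDiff
  hasCompactSupport' := g.hasCompactSupport.comp_left (map_zero _)
  tsupport_subset' := (closure_mono fun x hx => by simpa using hx).trans g.tsupport_subset

theorem TestFunction.conj_apply (g : 𝓓(U, ℂ)) (x : E) : g.conj x = (starRingEnd ℂ) (g x) := rfl

end

section TestFunctions

variable {E : Type*} [NormedAddCommGroup E] [MeasurableSpace E] [BorelSpace E]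

theorem withDensity_ofReal_lt_top_of_isCompact {μ : Measure E} [IsFiniteMeasureOnCompacts μ]
    {U K : Set E} {w : E → ℝ} (hw : ContinuousOn w U) (hK : IsCompact K) (hKU : K ⊆ U) :
    ((μ.restrict U).withDensity fun z => ENNReal.ofReal (w z)) K < ⊤ := by
  rw [withDensity_apply _ hK.measurableSet, Measure.restrict_restrict hK.measurableSet,
    inter_eq_left.2 hKU]
  have h : IntegrableOn w K μ := (hw.mono hKU).integrableOn_compact hK
  exact h.lintegral_lt_top

namespace TestFunction

variable [NormedSpace ℝ E] {U : TopologicalSpace.Opens E} {μ : Measure E}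

theorem memLp (hμ : ∀ K ⊆ (U : Set E), IsCompact K → μ K < ⊤) (g : 𝓓(U, ℂ)) (p : ℝ≥0∞) :
    MemLp g p μ := by
  obtain ⟨C, hC⟩ := g.continuous.bounded_above_of_compact_support g.hasCompactSupport
  have h1 : (tsupport g).indicator g = g :=
    indicator_eq_self.2 (subset_tsupport g)
  have : IsFiniteMeasure (μ.restrict (tsupport g)) :=
    ⟨by simpa using hμ _ g.tsupport_subset g.hasCompactSupport⟩
  rw [← h1, memLp_indicator_iff_restrict (isClosed_tsupport g).measurableSet]
  have hc : HasCompactSupport g := g.hasCompactSupport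
  exact MemLp.of_bound
    (g.continuous.stronglyMeasurable_of_hasCompactSupport hc).aestronglyMeasurable C
    (Filter.Eventually.of_forall hC)

/-- If `μ` lives on the open set `U` and is finite on its compact subsets, then a square integrable
function is determined by its integrals against test functions on `U`. -/
theorem eq_zero_of_forall_integral_mul_eq_zero [FiniteDimensional ℝ E]
    (hμ : ∀ K ⊆ (U : Set E), IsCompact K → μ K < ⊤) (hU : μ (U : Set E)ᶜ = 0) (F : Lp ℂ 2 μ)
    (h : ∀ g : 𝓓(U, ℂ), ∫ x, g x * F x ∂μ = 0) : F = 0 := by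
  rw [Lp.eq_zero_iff_ae_eq_zero]
  have hloc : LocallyIntegrableOn F U μ := by
    rw [locallyIntegrableOn_iff U.isOpen.isLocallyClosed]
    intro K hK hKc
    exact integrableOn_Lp_of_measure_ne_top F one_le_two (hμ K hK hKc).ne
  have h1 := U.isOpen.ae_eq_zero_of_integral_contDiff_smul_eq_zero hloc fun g hg hgc hgU => by
    have h2 := h ⟨fun x => (g x : ℂ), Complex.ofRealCLM.contDiff.comp hg,
      hgc.comp_left Complex.ofReal_zero,
      (closure_mono fun x hx => by simpa using hx).trans hgU⟩
    simp_rw [Complex.real_smul]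
    exact h2
  filter_upwards [h1, show ∀ᵐ x ∂μ, x ∈ (U : Set E) from hU] with x hx hxU
  exact hx hxU

end TestFunction

end TestFunctions

theorem mulHaar_lt_top_of_isCompact : ∀ K ⊆ (halfLine : Set ℝ), IsCompact K → mulHaar K < ⊤ :=
  fun _ hK hKc => withDensity_ofReal_lt_top_of_isCompact
    (continuousOn_inv₀.mono fun _ hr => ne_of_gt (show (0 : ℝ) < _ from hr)) hKc hK

theorem omegaMeasure_lt_top_of_isCompact :
    ∀ K ⊆ (halfPlane : Set (ℝ × ℝ)), IsCompact K → omegaMeasure K < ⊤ :=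
  fun _ hK hKc => withDensity_ofReal_lt_top_of_isCompact (U := (halfPlane : Set (ℝ × ℝ)))
    (w := fun z : ℝ × ℝ => z.2⁻¹)
    (continuousOn_snd.inv₀ fun _ hr => ne_of_gt (show (0 : ℝ) < _ from hr)) hKc hK

theorem mulHaar_compl_halfLine : mulHaar (halfLine : Set ℝ)ᶜ = 0 :=
  (withDensity_absolutelyContinuous _ _)
    (by rw [Measure.restrict_apply halfLine.isOpen.measurableSet.compl]
        exact (congrArg volume (compl_inter_self _)).trans measure_empty)

theorem omegaMeasure_compl_halfPlane : omegaMeasure (halfPlane : Set (ℝ × ℝ))ᶜ = 0 :=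
  (withDensity_absolutelyContinuous _ _)
    (by rw [Measure.restrict_apply halfPlane.isOpen.measurableSet.compl]; simp)

theorem ae_mulHaar_pos : ∀ᵐ r ∂mulHaar, 0 < r := by
  have h : ∀ᵐ r ∂mulHaar, r ∈ (halfLine : Set ℝ) := mulHaar_compl_halfLine
  exact h

/-- The element of `𝒦` given by a test function. -/
noncomputable def testVector (g : 𝓓(halfLine, ℂ)) : KSpace :=
  (g.memLp mulHaar_lt_top_of_isCompact 2).toLp

theorem testVector_coeFn (g : 𝓓(halfLine, ℂ)) : testVector g =ᵐ[mulHaar] g := MemLp.coeFn_toLp _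

theorem isTestVector_iff {ψ : KSpace} : IsTestVector ψ ↔ ∃ g, ψ = testVector g :=
  ⟨fun ⟨g, hg⟩ => ⟨g, Lp.ext (hg.trans (testVector_coeFn g).symm)⟩,
    fun ⟨g, hg⟩ => ⟨g, hg ▸ testVector_coeFn g⟩⟩

theorem isTotalFamily_testVector : IsTotalFamily testVector := by
  intro v hv
  refine TestFunction.eq_zero_of_forall_integral_mul_eq_zero mulHaar_lt_top_of_isCompact
    mulHaar_compl_halfLine v fun g => ?_
  have h := hv g.conj
  rw [L2.inner_def] at h
  rw [← h]
  refine integral_congr_ae ?_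
  filter_upwards [testVector_coeFn g.conj] with x hx
  rw [hx, RCLike.inner_apply, TestFunction.conj_apply, RCLike.conj_conj, mul_comm]

/-- A bounded operator is determined by its matrix elements between test functions. -/
theorem eq_of_forall_isTestVector {A B : KSpace →L[ℂ] KSpace}
    (h : ∀ φ ψ : KSpace, IsTestVector φ → IsTestVector ψ → inner ℂ φ (A ψ) = inner ℂ φ (B ψ)) :
    A = B := by
  refine isTotalFamily_testVector.eq_of_semilinear A B fun g => sub_eq_zero.1 ?_
  refine isTotalFamily_testVector _ fun k => ?_
  rw [inner_sub_right, h _ _ (isTestVector_iff.2 ⟨k, rfl⟩) (isTestVector_iff.2 ⟨g, rfl⟩), sub_self]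

/-! ### The change of variables -/

instance : SigmaFinite mulHaar :=
  SigmaFinite.withDensity (μ := volume.restrict (Ioi 0)) fun r : ℝ => Real.toNNReal r⁻¹

theorem omegaMeasure_eq_prod : omegaMeasure = (volume : Measure ℝ).prod mulHaar := by
  rw [mulHaar, prod_withDensity_right (by fun_prop), omegaMeasure]
  congr 1
  have h : (halfPlane : Set (ℝ × ℝ)) = univ ×ˢ Ioi 0 := by
    ext z; simp [halfPlane]
  rw [h, Measure.volume_eq_prod, ← Measure.prod_restrict, Measure.restrict_univ]

theorem measurePreserving_exp : MeasurePreserving Real.exp volume mulHaar := by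
  refine ⟨Real.measurable_exp, ?_⟩
  ext s hs
  rw [Measure.map_apply Real.measurable_exp hs, mulHaar, withDensity_apply _ hs,
    Measure.restrict_restrict hs, inter_comm, ← Measure.restrict_restrict measurableSet_Ioi]
  have h := lintegral_image_eq_lintegral_abs_deriv_mul MeasurableSet.univ
    (fun x _ => (Real.hasDerivAt_exp x).hasDerivWithinAt) Real.exp_injective.injOn
    (s.indicator fun r => ENNReal.ofReal r⁻¹)
  rw [image_univ, Real.range_exp, Measure.restrict_univ] at h
  rw [Measure.restrict_restrict measurableSet_Ioi, inter_comm, ← Measure.restrict_restrict hs,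
    ← lintegral_indicator hs, h, ← lintegral_indicator_one (Real.measurable_exp hs)]
  refine lintegral_congr fun x => ?_
  by_cases hx : Real.exp x ∈ s
  · rw [indicator_of_mem (show x ∈ Real.exp ⁻¹' s from hx), indicator_of_mem hx,
      ← ENNReal.ofReal_mul (abs_nonneg _), abs_of_pos (Real.exp_pos x),
      mul_inv_cancel₀ (Real.exp_pos x).ne']
    simp
  · rw [indicator_of_notMem (show x ∉ Real.exp ⁻¹' s from hx), indicator_of_notMem hx, mul_zero]

theorem lam_pos (t : ℝ) : 0 < lam t := by
  rw [lam]
  split_ifs with h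
  · exact one_pos
  · rcases lt_or_gt_of_ne h with h | h
    · exact div_pos_of_neg_of_neg h (by simpa using h)
    · exact div_pos h (by simpa using h)

theorem lam_eq_exp_mul_lam_neg (t : ℝ) : lam t = Real.exp t * lam (-t) := by
  by_cases h : t = 0
  · simp [lam, h]
  · have h' : -t ≠ 0 := neg_ne_zero.2 h
    have h1 : 1 - Real.exp t ≠ 0 := by
      rw [sub_ne_zero, ne_comm]
      simpa using h
    have h2 : 1 - Real.exp (-t) ≠ 0 := by
      rw [sub_ne_zero, ne_comm]
      simpa using h
    rw [lam, lam, if_neg h, if_neg h', neg_neg]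
    rw [Real.exp_neg] at h2 ⊢
    field_simp
    have h3 : Real.exp t ≠ 0 := (Real.exp_pos t).ne'
    have h4 : Real.exp t - 1 ≠ 0 := by
      intro h5; apply h1; linarith
    field_simp
    ring

theorem measurable_lam : Measurable lam := by
  unfold lam
  exact Measurable.ite (measurableSet_singleton 0) measurable_const (by fun_prop)

/-- The change of variables `(u, y) ↦ (y λ(-u), y λ(u))`. The operator `Ω(x + i y)` acts, up to the
phase `exp(-2πi u x)`, by evaluation at these pairs of points. -/
noncomputable def pairMap (p : ℝ × ℝ) : ℝ × ℝ := (lam (-p.1) * p.2, lam p.1 * p.2)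

/-- The inverse of `pairMap` on the pairs of positive numbers; the first coordinate is recovered
from `λ(u) = eᵘ λ(-u)`. -/
noncomputable def pairMapInv (p : ℝ × ℝ) : ℝ × ℝ :=
  (Real.log (p.2 / p.1), p.1 / lam (-Real.log (p.2 / p.1)))

theorem measurable_pairMapInv : Measurable pairMapInv := by
  unfold pairMapInv
  have := measurable_lam
  fun_prop

/-- The map is the composition of the dilations `y ↦ λ(-u) y`, which depend on `u`, with
`(u, s) ↦ (s, eᵘ s)`. -/
theorem measurePreserving_pairMap :
    MeasurePreserving pairMap (volume.prod mulHaar) (mulHaar.prod mulHaar) := by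
  have hl := measurable_lam
  have h1 : MeasurePreserving (fun p : ℝ × ℝ => (p.1, lam (-p.1) * p.2)) (volume.prod mulHaar)
      (volume.prod mulHaar) :=
    (MeasurePreserving.id volume).skew_product (g := fun u y => lam (-u) * y)
      (by unfold Function.uncurry; fun_prop)
      (Filter.Eventually.of_forall fun u => (measurePreserving_dilation _ (lam_pos _)).map_eq)
  have h2 : MeasurePreserving (fun p : ℝ × ℝ => (p.1, p.1 * Real.exp p.2)) (mulHaar.prod volume)
      (mulHaar.prod mulHaar) := by
    refine (MeasurePreserving.id mulHaar).skew_product (g := fun s u => s * Real.exp u)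
      (by unfold Function.uncurry; fun_prop) ?_
    filter_upwards [ae_mulHaar_pos] with s hs
    exact ((measurePreserving_dilation s hs).comp measurePreserving_exp).map_eq
  have h3 := h2.comp (Measure.measurePreserving_swap.comp h1)
  convert h3 using 1
  ext p
  · rfl
  · simp only [pairMap, Function.comp_apply, Prod.swap_prod_mk, lam_eq_exp_mul_lam_neg p.1]
    ring

theorem pairMapInv_pairMap {p : ℝ × ℝ} (h : 0 < p.2) : pairMapInv (pairMap p) = p := by
  have h1 := lam_pos (-p.1)
  have h2 : lam p.1 * p.2 / (lam (-p.1) * p.2) = Real.exp p.1 := by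
    rw [lam_eq_exp_mul_lam_neg p.1]
    field_simp
  have h3 : (pairMapInv (pairMap p)).1 = p.1 := by
    simp only [pairMap, pairMapInv]
    rw [h2, Real.log_exp]
  ext
  · exact h3
  · change lam (-p.1) * p.2 / lam (-(pairMapInv (pairMap p)).1) = p.2
    rw [h3]
    field_simp

/-- The left inverse of a measure preserving map preserves the measures as well. -/
theorem measurePreserving_pairMapInv :
    MeasurePreserving pairMapInv (mulHaar.prod mulHaar) (volume.prod mulHaar) := by
  refine ⟨measurable_pairMapInv, ?_⟩
  rw [← measurePreserving_pairMap.map_eq,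
    Measure.map_map measurable_pairMapInv measurePreserving_pairMap.measurable]
  conv_rhs => rw [← Measure.map_id (μ := (volume : Measure ℝ).prod mulHaar)]
  refine Measure.map_congr ?_
  filter_upwards [Measure.quasiMeasurePreserving_snd.ae ae_mulHaar_pos] with p hp
  exact pairMapInv_pairMap hp

/-- Composition with `pairMap`, as a unitary operator. -/
noncomputable def pairUnitary :
    Lp ℂ 2 (mulHaar.prod mulHaar) ≃ₗᵢ[ℂ] Lp ℂ 2 ((volume : Measure ℝ).prod mulHaar) :=
  LinearIsometryEquiv.ofSurjective
    (Lp.compMeasurePreservingₗᵢ ℂ pairMap measurePreserving_pairMap) fun g => by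
      refine ⟨Lp.compMeasurePreserving pairMapInv measurePreserving_pairMapInv g, ?_⟩
      ext1
      have h1 := Lp.coeFn_compMeasurePreserving
        (Lp.compMeasurePreserving pairMapInv measurePreserving_pairMapInv g)
        measurePreserving_pairMap
      have h2 := measurePreserving_pairMap.quasiMeasurePreserving.ae_eq_comp
        (Lp.coeFn_compMeasurePreserving g measurePreserving_pairMapInv)
      filter_upwards [h1, h2, Measure.quasiMeasurePreserving_snd.ae ae_mulHaar_pos] with p e1 e2 hp
      refine e1.trans (e2.trans ?_)
      simp only [Function.comp_apply]
      rw [pairMapInv_pairMap hp]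

theorem pairUnitary_coeFn (g : Lp ℂ 2 (mulHaar.prod mulHaar)) :
    pairUnitary g =ᵐ[volume.prod mulHaar] fun p => g (pairMap p) :=
  Lp.coeFn_compMeasurePreserving g measurePreserving_pairMap

/-! ### Matrix elements of the Weyl operators -/

section Decay

open FourierTransform

theorem integrable_mul_dilation {a g : ℝ → ℂ} (ha : Continuous a) (ha' : HasCompactSupport a)
    (hg : Continuous g) (c : ℝ) : Integrable fun r => a r * g (c * r) :=
  Continuous.integrable_of_hasCompactSupport (by fun_prop) ha'.mul_right

/-- The Fourier transforms of the functions `r ↦ a r * g (c r)` decrease rapidly, uniformly for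
bounded `c`: each factor `ξ` is traded for a derivative, which falls on `a` or on `g`. -/
theorem exists_pow_mul_norm_fourier_le (n : ℕ) (c₀ : ℝ) {a g : ℝ → ℂ} (ha : ContDiff ℝ ∞ a)
    (ha' : HasCompactSupport a) (hg : ContDiff ℝ ∞ g) (hg' : HasCompactSupport g) :
    ∃ C, ∀ c : ℝ, 0 ≤ c → c ≤ c₀ → ∀ ξ : ℝ,
      |ξ| ^ n * ‖𝓕 (fun r => a r * g (c * r)) ξ‖ ≤ C := by
  induction n generalizing a g with
  | zero =>
    obtain ⟨B, hB⟩ := hg.continuous.bounded_above_of_compact_support hg'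
    refine ⟨∫ r, ‖a r‖ * B, fun c _ _ ξ => ?_⟩
    rw [pow_zero, one_mul]
    refine (VectorFourier.norm_fourierIntegral_le_integral_norm _ _ _ _ _).trans ?_
    refine integral_mono (integrable_mul_dilation ha.continuous ha' hg.continuous c).norm
      ((ha.continuous.integrable_of_hasCompactSupport ha').norm.mul_const _) fun r => ?_
    simp only [norm_mul]
    gcongr
    exact hB _
  | succ n ih =>
    have had : ContDiff ℝ ∞ (deriv a) := (contDiff_infty_iff_deriv.1 ha).2
    have hgd : ContDiff ℝ ∞ (deriv g) := (contDiff_infty_iff_deriv.1 hg).2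
    obtain ⟨C₁, h₁⟩ := ih had ha'.deriv hg hg'
    obtain ⟨C₂, h₂⟩ := ih ha ha' hgd hg'.deriv
    refine ⟨C₁ + c₀ * C₂, fun c hc hc₀ ξ => ?_⟩
    have hda : Differentiable ℝ a := (contDiff_infty_iff_deriv.1 ha).1
    have hdg : Differentiable ℝ g := (contDiff_infty_iff_deriv.1 hg).1
    have hi₁ := integrable_mul_dilation had.continuous ha'.deriv hg.continuous c
    have hi₂ := integrable_mul_dilation ha.continuous ha' hgd.continuous c
    have hder : deriv (fun r => a r * g (c * r)) =
        (fun r => deriv a r * g (c * r)) + (c : ℂ) • fun r => a r * deriv g (c * r) := by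
      ext r
      have h1 : HasDerivAt (fun r => g (c * r)) (c • deriv g (c * r)) r := by
        have h2 := (hdg (c * r)).hasDerivAt.scomp r ((hasDerivAt_id r).const_mul c)
        simpa using! h2
      have h3 := (hda r).hasDerivAt.fun_mul h1
      rw [h3.deriv]
      simp only [Pi.add_apply, Pi.smul_apply, smul_eq_mul, Complex.real_smul]
      ring
    have hF := congrFun (Real.fourier_deriv
      (integrable_mul_dilation ha.continuous ha' hg.continuous c) (by fun_prop)
      (by rw [hder]; exact hi₁.add (hi₂.smul (c : ℂ)))) ξ
    have hadd : 𝓕 ((fun r => deriv a r * g (c * r)) + (c : ℂ) • fun r => a r * deriv g (c * r)) ξ =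
        𝓕 (fun r => deriv a r * g (c * r)) ξ + (c : ℂ) • 𝓕 (fun r => a r * deriv g (c * r)) ξ := by
      simp only [Real.fourier_eq, Pi.add_apply, Pi.smul_apply, smul_add]
      rw [integral_add, ← integral_smul]
      · simp_rw [smul_comm _ (c : ℂ)]
      · exact (Real.fourierIntegral_convergent_iff ξ).2 hi₁
      · exact (Real.fourierIntegral_convergent_iff ξ).2 (hi₂.smul (c : ℂ))
    rw [hder, hadd] at hF
    have hπ : |ξ| * ‖𝓕 (fun r => a r * g (c * r)) ξ‖ ≤
        ‖𝓕 (fun r => deriv a r * g (c * r)) ξ‖ + c * ‖𝓕 (fun r => a r * deriv g (c * r)) ξ‖ := by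
      calc |ξ| * ‖𝓕 (fun r => a r * g (c * r)) ξ‖
          ≤ 2 * Real.pi * (|ξ| * ‖𝓕 (fun r => a r * g (c * r)) ξ‖) := by
            refine le_mul_of_one_le_left (by positivity) ?_
            linarith [Real.two_le_pi]
        _ = ‖(2 * Real.pi * Complex.I * ξ : ℂ) • 𝓕 (fun r => a r * g (c * r)) ξ‖ := by
            rw [norm_smul]
            simp [abs_of_pos Real.pi_pos]
            ring
        _ ≤ _ := by
            rw [← hF]
            refine (norm_add_le _ _).trans ?_
            rw [norm_smul, Complex.norm_real, Real.norm_of_nonneg hc]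
    have h2 := h₂ c hc hc₀ ξ
    have h0 : 0 ≤ C₂ := le_trans (by positivity) h2
    calc |ξ| ^ (n + 1) * ‖𝓕 (fun r => a r * g (c * r)) ξ‖
        = |ξ| ^ n * (|ξ| * ‖𝓕 (fun r => a r * g (c * r)) ξ‖) := by ring
      _ ≤ |ξ| ^ n * (‖𝓕 (fun r => deriv a r * g (c * r)) ξ‖ +
            c * ‖𝓕 (fun r => a r * deriv g (c * r)) ξ‖) := by gcongr
      _ = |ξ| ^ n * ‖𝓕 (fun r => deriv a r * g (c * r)) ξ‖ +
            c * (|ξ| ^ n * ‖𝓕 (fun r => a r * deriv g (c * r)) ξ‖) := by ring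
      _ ≤ C₁ + c₀ * C₂ := add_le_add (h₁ c hc hc₀ ξ) (mul_le_mul hc₀ h2 (by positivity)
          (hc.trans hc₀))

end Decay

theorem lam_le (t : ℝ) : lam t ≤ 1 + |t| := by
  have key : ∀ t : ℝ, 0 ≤ t → lam t ≤ 1 + t := by
    intro t ht
    rcases ht.eq_or_lt with rfl | ht
    · simp [lam]
    · have h1 : 0 < 1 - Real.exp (-t) := by simpa using ht
      rw [lam, if_neg ht.ne', div_le_iff₀ h1]
      have h2 : (1 + t) * Real.exp (-t) ≤ 1 := by
        calc (1 + t) * Real.exp (-t) ≤ Real.exp t * Real.exp (-t) := by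
              gcongr
              linarith [Real.add_one_le_exp t]
          _ = 1 := by rw [← Real.exp_add]; simp
      nlinarith
  rcases le_total 0 t with ht | ht
  · rw [abs_of_nonneg ht]
    exact key t ht
  · rw [abs_of_nonpos ht, lam_eq_exp_mul_lam_neg]
    refine le_trans ?_ (key (-t) (neg_nonneg.2 ht))
    exact mul_le_of_le_one_left (lam_pos _).le (Real.exp_le_one_iff.2 ht)

theorem exp_div_lam (t : ℝ) : Real.exp t / lam t = (lam (-t))⁻¹ := by
  rw [lam_eq_exp_mul_lam_neg t, div_mul_eq_div_div, div_self (Real.exp_pos t).ne', one_div]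

section MatrixElements

open FourierTransform

theorem integral_mulHaar (F : ℝ → ℂ) :
    ∫ r, F r ∂mulHaar = ∫ r in Ioi (0 : ℝ), ((r⁻¹ : ℝ) : ℂ) * F r := by
  rw [mulHaar, integral_withDensity_eq_integral_toReal_smul (by fun_prop) (by simp)]
  refine setIntegral_congr_fun measurableSet_Ioi fun r hr => ?_
  change (ENNReal.ofReal r⁻¹).toReal • F r = _
  rw [ENNReal.toReal_ofReal (inv_nonneg.2 (le_of_lt hr)), Complex.real_smul]

/-- The function `r ↦ conj (f r) / r` for a test function `f` on `(0, ∞)`. -/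
noncomputable def conjDiv (f : 𝓓(halfLine, ℂ)) (r : ℝ) : ℂ :=
  ((r⁻¹ : ℝ) : ℂ) * (starRingEnd ℂ) (f r)

theorem tsupport_conjDiv_subset (f : 𝓓(halfLine, ℂ)) : tsupport (conjDiv f) ⊆ tsupport f :=
  closure_mono fun r hr => by
    simp only [Function.mem_support, conjDiv] at hr ⊢
    intro h
    simp [h] at hr

theorem hasCompactSupport_conjDiv (f : 𝓓(halfLine, ℂ)) : HasCompactSupport (conjDiv f) :=
  f.hasCompactSupport.of_isClosed_subset (isClosed_tsupport _) (tsupport_conjDiv_subset f)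

theorem contDiff_conjDiv (f : 𝓓(halfLine, ℂ)) : ContDiff ℝ ∞ (conjDiv f) := by
  refine contDiff_iff_contDiffAt.2 fun r => ?_
  by_cases hr : r ∈ tsupport (conjDiv f)
  swap
  · exact contDiffAt_const.congr_of_eventuallyEq (notMem_tsupport_iff_eventuallyEq.1 hr)
  have h0 : (0 : ℝ) < r := f.tsupport_subset (tsupport_conjDiv_subset f hr)
  have h1 : ContDiffAt ℝ ∞ (fun r : ℝ => ((r⁻¹ : ℝ) : ℂ)) r :=
    Complex.ofRealCLM.contDiff.contDiffAt.comp r (contDiffAt_inv ℝ h0.ne')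
  exact h1.mul f.conj.contDiff.contDiffAt

theorem TestFunction.eq_zero_of_nonpos (f : 𝓓(halfLine, ℂ)) {r : ℝ} (hr : r ≤ 0) : f r = 0 := by
  by_contra h
  exact not_lt.2 hr (f.tsupport_subset (subset_tsupport f h))

/-- The matrix elements of the Weyl operators are Fourier integrals. -/
theorem inner_weylOp_testVector (f g : 𝓓(halfLine, ℂ)) (u v : ℝ) :
    inner ℂ (testVector f) (weylOp u v (testVector g)) =
      𝓕⁻ (fun r => conjDiv f r * g (Real.exp u * r)) (v * (lam (-u))⁻¹) := by
  rw [L2.inner_def, Real.fourierInv_eq']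
  have h1 : ∀ᵐ r ∂mulHaar, inner ℂ (testVector f r) (weylOp u v (testVector g) r) =
      (starRingEnd ℂ) (f r) * (Complex.exp (2 * Real.pi * Complex.I *
        ((v * (lam (-u))⁻¹ : ℝ) : ℂ) * r) * g (Real.exp u * r)) := by
    filter_upwards [testVector_coeFn f, affineRep_coeFn (Real.exp u) (v * Real.exp u / lam u)
      (Real.exp_pos u) (testVector g),
      (measurePreserving_dilation _ (Real.exp_pos u)).quasiMeasurePreserving.ae_eq_comp
        (testVector_coeFn g)] with r e1 e2 e3
    simp only [Function.comp_apply] at e3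
    rw [weylOp, e1, e2, e3, RCLike.inner_apply, mul_div_assoc, exp_div_lam, mul_comm]
  rw [integral_congr_ae h1, integral_mulHaar, ← integral_indicator measurableSet_Ioi]
  congr 1
  ext r
  by_cases hr : r ∈ Ioi (0 : ℝ)
  · rw [indicator_of_mem hr, conjDiv, smul_eq_mul]
    have h2 : ((2 * Real.pi * inner ℝ r (v * (lam (-u))⁻¹) : ℝ) : ℂ) * Complex.I =
        2 * Real.pi * Complex.I * ((v * (lam (-u))⁻¹ : ℝ) : ℂ) * r := by
      simp only [RCLike.inner_apply, conj_trivial]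
      push_cast
      ring
    rw [h2]
    ring
  · rw [indicator_of_notMem hr, conjDiv, f.eq_zero_of_nonpos (not_lt.1 hr)]
    simp

/-- If `f r` and `g (eᵘ r)` do not vanish, then `log r` and `u + log r` are both bounded. -/
theorem exists_bounds_of_ne_zero (f g : 𝓓(halfLine, ℂ)) :
    ∃ R, ∀ u r : ℝ, conjDiv f r * g (Real.exp u * r) ≠ 0 → |u| ≤ R := by
  have key : ∀ k : 𝓓(halfLine, ℂ), ∃ B, ∀ r, k r ≠ 0 → |Real.log r| ≤ B := by
    intro k
    have h1 : ContinuousOn (fun r => |Real.log r|) (tsupport k) := fun r hr =>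
      (Real.continuousAt_log
        (ne_of_gt (show (0 : ℝ) < r from k.tsupport_subset hr))).abs.continuousWithinAt
    obtain ⟨B, hB⟩ := k.hasCompactSupport.isCompact.bddAbove_image h1
    exact ⟨B, fun r hr => hB ⟨r, subset_tsupport k hr, rfl⟩⟩
  obtain ⟨B₁, h₁⟩ := key f
  obtain ⟨B₂, h₂⟩ := key g
  refine ⟨B₂ + B₁, fun u r h => ?_⟩
  have hf : f r ≠ 0 := fun h0 => h (by simp [conjDiv, h0])
  have hg : g (Real.exp u * r) ≠ 0 := right_ne_zero_of_mul h
  have hr : 0 < r := not_le.1 fun h0 => hf (f.eq_zero_of_nonpos h0)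
  have h3 : u = Real.log (Real.exp u * r) - Real.log r := by
    rw [Real.log_mul (Real.exp_pos u).ne' hr.ne', Real.log_exp]
    ring
  rw [h3]
  exact (abs_sub _ _).trans (add_le_add (h₂ _ hg) (h₁ _ hf))

/-- The matrix elements of the Weyl operators vanish for large `u`, and they decrease like `v⁻²`
in `v`, uniformly in `u`. -/
theorem exists_norm_inner_weylOp_le (f g : 𝓓(halfLine, ℂ)) :
    ∃ R C, ∀ u v : ℝ, ‖(inner ℂ (testVector f) (weylOp u v (testVector g)) : ℂ)‖ ≤
      (Icc (-R) R).indicator (fun _ => C) u * (1 + v ^ 2)⁻¹ := by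
  obtain ⟨R, hR⟩ := exists_bounds_of_ne_zero f g
  obtain ⟨C₀, h₀⟩ := exists_pow_mul_norm_fourier_le 0 (Real.exp R) (contDiff_conjDiv f)
    (hasCompactSupport_conjDiv f) g.contDiff g.hasCompactSupport
  obtain ⟨C₂, h₂⟩ := exists_pow_mul_norm_fourier_le 2 (Real.exp R) (contDiff_conjDiv f)
    (hasCompactSupport_conjDiv f) g.contDiff g.hasCompactSupport
  refine ⟨R, C₀ + (1 + R) ^ 2 * C₂, fun u v => ?_⟩
  rw [inner_weylOp_testVector]
  by_cases hu : |u| ≤ R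
  · -- the Fourier transform is taken at `v / λ(-u)`, and `λ(-u) ≤ 1 + R`
    have hu' := abs_le.1 hu
    have hl := lam_pos (-u)
    have hl2 : lam (-u) ≤ 1 + R := (lam_le _).trans (by rw [abs_neg]; linarith)
    rw [indicator_of_mem (mem_Icc.2 hu'), le_mul_inv_iff₀ (by positivity),
      Real.fourierInv_eq_fourier_neg]
    have hc := Real.exp_le_exp.2 hu'.2
    have e0 := h₀ _ (Real.exp_pos u).le hc (-(v * (lam (-u))⁻¹))
    have e2 := h₂ _ (Real.exp_pos u).le hc (-(v * (lam (-u))⁻¹))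
    set N := ‖𝓕 (fun r => conjDiv f r * g (Real.exp u * r)) (-(v * (lam (-u))⁻¹))‖ with hN
    have hN0 : 0 ≤ N := norm_nonneg _
    rw [pow_zero, one_mul] at e0
    rw [sq_abs, neg_sq, mul_pow, inv_pow] at e2
    have hC2 : 0 ≤ C₂ := le_trans (by positivity) e2
    have e3 : v ^ 2 * N ≤ (1 + R) ^ 2 * C₂ := by
      calc v ^ 2 * N = lam (-u) ^ 2 * (v ^ 2 * (lam (-u) ^ 2)⁻¹ * N) := by field_simp
        _ ≤ (1 + R) ^ 2 * C₂ := by gcongr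
    linarith
  · have h0 : (fun r => conjDiv f r * g (Real.exp u * r)) = 0 := by
      ext r
      by_contra h
      exact hu (hR u r h)
    rw [h0, indicator_of_notMem fun h => hu (abs_le.2 (mem_Icc.1 h)), Real.fourierInv_eq]
    simp

theorem integrable_quantizerIntegrand (z : ℝ × ℝ) (f g : 𝓓(halfLine, ℂ)) :
    Integrable (quantizerIntegrand z (testVector f) (testVector g)) := by
  obtain ⟨R, C, h⟩ := exists_norm_inner_weylOp_le f g
  have hdom : Integrable fun p : ℝ × ℝ =>
      (Icc (-R) R).indicator (fun _ => C) p.1 * (1 + p.2 ^ 2)⁻¹ := by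
    refine Integrable.mul_prod ?_ integrable_inv_one_add_sq
    exact (integrable_indicator_iff measurableSet_Icc).2 (integrableOn_const (by simp))
  refine hdom.mono' ?_ (Filter.Eventually.of_forall fun p => ?_)
  · refine Measurable.aestronglyMeasurable (Measurable.mul (by fun_prop) ?_)
    simp_rw [inner_weylOp_testVector, Real.fourierInv_eq']
    have hl := measurable_lam
    have h1 : Measurable (conjDiv f) := (contDiff_conjDiv f).continuous.measurable
    have h2 : Measurable g := g.continuous.measurable
    refine StronglyMeasurable.measurable ?_
    refine StronglyMeasurable.integral_prod_right (ν := volume) (f := fun (p : ℝ × ℝ) (r : ℝ) =>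
      Complex.exp (((2 * Real.pi * inner ℝ r (p.2 * (lam (-p.1))⁻¹) : ℝ) : ℂ) * Complex.I) •
        (conjDiv f r * g (Real.exp p.1 * r))) ?_
    refine Measurable.stronglyMeasurable ?_
    unfold Function.uncurry
    fun_prop
  · rw [quantizerIntegrand, norm_mul]
    have h1 : (-(2 * Real.pi * Complex.I * (p.1 * z.1 + p.2 * z.2)) : ℂ) =
        ((-(2 * Real.pi * (p.1 * z.1 + p.2 * z.2)) : ℝ) : ℂ) * Complex.I := by
      push_cast
      ring
    rw [h1, Complex.norm_exp_ofReal_mul_I, one_mul]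
    exact h _ _

/-! ### The kernel of the quantizer -/

/-- The integral over `v` undoes the Fourier transform in `inner_weylOp_testVector`. -/
theorem quantizer_testVector {z : ℝ × ℝ} (hz : 0 < z.2) (f g : 𝓓(halfLine, ℂ)) :
    quantizer z (testVector f) (testVector g) =
      ∫ u : ℝ, Complex.exp (-(2 * Real.pi * Complex.I * u * z.1)) *
        ((starRingEnd ℂ) (f (pairMap (u, z.2)).1) * g (pairMap (u, z.2)).2) := by
  have hi : Integrable (quantizerIntegrand z (testVector f) (testVector g))
    ((volume : Measure ℝ).prod volume) := integrable_quantizerIntegrand z f g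
  rw [quantizer, Measure.volume_eq_prod, integral_prod _ hi, ← integral_const_mul]
  refine integral_congr_ae (Filter.Eventually.of_forall fun u => ?_)
  have hl := lam_pos (-u)
  have hs1 : HasCompactSupport fun r => conjDiv f r * g (Real.exp u * r) :=
    (hasCompactSupport_conjDiv f).mul_right
  have hs2 : ContDiff ℝ ∞ fun r => conjDiv f r * g (Real.exp u * r) :=
    (contDiff_conjDiv f).mul (g.contDiff.comp (by fun_prop))
  set h : ℝ → ℂ := fun r => conjDiv f r * g (Real.exp u * r) with hh
  have hinv : 𝓕 (𝓕⁻ h) = h := by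
    have h1 := FourierTransform.fourier_fourierInv_eq (F := SchwartzMap ℝ ℂ) (hs1.toSchwartzMap hs2)
    have h2 := congrArg (fun S : SchwartzMap ℝ ℂ => (S : ℝ → ℂ)) h1
    simpa only [SchwartzMap.fourier_coe, SchwartzMap.fourierInv_coe] using! h2
  -- the substitution `w = v / λ(-u)` makes the integral over `v` a Fourier integral
  have hv : ∫ v : ℝ, quantizerIntegrand z (testVector f) (testVector g) (u, v) =
      Complex.exp (-(2 * Real.pi * Complex.I * u * z.1)) * (lam (-u) * h (lam (-u) * z.2)) := by
    have h3 : ∀ v : ℝ, quantizerIntegrand z (testVector f) (testVector g) (u, v) =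
        Complex.exp (-(2 * Real.pi * Complex.I * u * z.1)) *
          (fun w : ℝ => Complex.exp (((-2 * Real.pi * w * (lam (-u) * z.2) : ℝ) : ℂ) * Complex.I) •
            𝓕⁻ h w) (v * (lam (-u))⁻¹) := by
      intro v
      simp only [quantizerIntegrand]
      rw [inner_weylOp_testVector, smul_eq_mul, ← mul_assoc, ← Complex.exp_add]
      congr 2
      have h4 : (lam (-u) : ℂ) ≠ 0 := by exact_mod_cast hl.ne'
      push_cast
      field_simp
      ring
    rw [integral_congr_ae (Filter.Eventually.of_forall h3), integral_const_mul,
      Measure.integral_comp_mul_right (fun w : ℝ =>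
        Complex.exp (((-2 * Real.pi * w * (lam (-u) * z.2) : ℝ) : ℂ) * Complex.I) • 𝓕⁻ h w),
      ← Real.fourier_real_eq_integral_exp_smul, hinv, inv_inv, abs_of_pos hl, Complex.real_smul]
  simp only
  rw [hv, hh]
  simp only [conjDiv, pairMap]
  rw [← mul_assoc (Real.exp u), ← lam_eq_exp_mul_lam_neg, abs_of_pos hz]
  have h5 : (lam (-u) : ℂ) ≠ 0 := by exact_mod_cast hl.ne'
  have h6 : (z.2 : ℂ) ≠ 0 := by exact_mod_cast hz.ne'
  push_cast
  field_simp

end MatrixElements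

/-! ### Complex conjugation in `L²` -/

section Star

variable {α : Type*} [MeasurableSpace α] {μ : Measure α}

theorem Lp.inner_star_star (a b : Lp ℂ 2 μ) : inner ℂ (star a) (star b) = inner ℂ b a := by
  rw [L2.inner_def, L2.inner_def]
  refine integral_congr_ae ?_
  filter_upwards [Lp.coeFn_star a, Lp.coeFn_star b] with x h1 h2
  rw [h1, h2]
  simp only [Pi.star_apply, RCLike.star_def, RCLike.inner_apply, RCLike.conj_conj]
  ring

theorem Lp.inner_star_eq_integral (f g : Lp ℂ 2 μ) :
    inner ℂ (star f) g = ∫ x, f x * g x ∂μ := by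
  rw [L2.inner_def]
  refine integral_congr_ae ?_
  filter_upwards [Lp.coeFn_star f] with x h1
  rw [h1]
  simp only [Pi.star_apply, RCLike.star_def, RCLike.inner_apply, RCLike.conj_conj]
  ring

/-- Complex conjugation, as an antilinear isometry of `L²`. -/
noncomputable def Lp.conjIsometry : Lp ℂ 2 μ →ₗᵢ⋆[ℂ] Lp ℂ 2 μ where
  toFun f := star f
  map_add' f g := by
    ext1
    filter_upwards [Lp.coeFn_star (f + g), Lp.coeFn_add f g, Lp.coeFn_star f, Lp.coeFn_star g,
      Lp.coeFn_add (star f) (star g)] with x h1 h2 h3 h4 h5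
    rw [h1, h5, Pi.star_apply, h2, Pi.add_apply, Pi.add_apply, h3, h4, star_add]
    rfl
  map_smul' c f := by
    ext1
    filter_upwards [Lp.coeFn_star (c • f), Lp.coeFn_smul c f, Lp.coeFn_star f,
      Lp.coeFn_smul ((starRingEnd ℂ) c) (star f)] with x h1 h2 h3 h4
    rw [h1, h4, Pi.star_apply, h2, Pi.smul_apply, Pi.smul_apply, h3, Pi.star_apply, star_smul]
    rfl
  norm_map' f := by
    change ‖star f‖ = ‖f‖
    rw [@norm_eq_sqrt_re_inner ℂ, @norm_eq_sqrt_re_inner ℂ, Lp.inner_star_star]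

end Star

/-! ### Quantization and dequantization -/

open HilbertSchmidt

theorem isTotalFamily_ketBra_testVector :
    IsTotalFamily fun p : 𝓓(halfLine, ℂ) × 𝓓(halfLine, ℂ) =>
      ketBra (testVector p.1) (testVector p.2) := by
  intro A hA
  apply toOp_injective
  refine eq_of_forall_isTestVector fun φ ψ hφ hψ => ?_
  obtain ⟨f, rfl⟩ := isTestVector_iff.1 hφ
  obtain ⟨g, rfl⟩ := isTestVector_iff.1 hψ
  rw [← inner_ketBra, hA (f, g), map_zero]
  simp

/-- The function `(u, y) ↦ f (y λ(-u)) * conj (g (y λ(u)))`. -/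
noncomputable def pairFun (f g : 𝓓(halfLine, ℂ)) (p : ℝ × ℝ) : ℂ :=
  f (pairMap p).1 * g.conj (pairMap p).2

theorem integrable_pairFun (f g : 𝓓(halfLine, ℂ)) :
    Integrable (pairFun f g) (volume.prod mulHaar) := by
  have h : ∀ k : 𝓓(halfLine, ℂ), Integrable k mulHaar := fun k =>
    memLp_one_iff_integrable.1 (k.memLp mulHaar_lt_top_of_isCompact 1)
  exact measurePreserving_pairMap.integrable_comp_of_integrable ((h f).mul_prod (h g.conj))

theorem memLp_pairFun (f g : 𝓓(halfLine, ℂ)) :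
    MemLp (pairFun f g) 2 (volume.prod mulHaar) :=
  (memLp_two_mul_prod (f.memLp mulHaar_lt_top_of_isCompact 2)
    (g.conj.memLp mulHaar_lt_top_of_isCompact 2)).comp_measurePreserving measurePreserving_pairMap

theorem pairUnitary_tensor_testVector (f g : 𝓓(halfLine, ℂ)) :
    pairUnitary (Lp.tensor (testVector f) (star (testVector g))) = (memLp_pairFun f g).toLp := by
  ext1
  have h1 : Lp.tensor (testVector f) (star (testVector g)) =ᵐ[mulHaar.prod mulHaar]
      fun p => f p.1 * g.conj p.2 := by
    filter_upwards [Lp.coeFn_tensor (testVector f) (star (testVector g)),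
      Measure.quasiMeasurePreserving_fst.ae_eq_comp (testVector_coeFn f),
      Measure.quasiMeasurePreserving_snd.ae_eq_comp (testVector_coeFn g),
      Measure.quasiMeasurePreserving_snd.ae_eq_comp
        (Lp.coeFn_star (testVector g))] with p e1 e2 e3 e4
    simp only [Function.comp_apply] at e2 e3 e4
    rw [e1, e2, e4, Pi.star_apply, e3, TestFunction.conj_apply, RCLike.star_def]
  filter_upwards [pairUnitary_coeFn (Lp.tensor (testVector f) (star (testVector g))),
    (memLp_pairFun f g).coeFn_toLp,
    measurePreserving_pairMap.quasiMeasurePreserving.ae_eq_comp h1] with p e1 e2 e3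
  simp only [Function.comp_apply] at e3
  rw [e1, e2, e3, pairFun]

theorem conj_quantizer_testVector {z : ℝ × ℝ} (hz : 0 < z.2) (f g : 𝓓(halfLine, ℂ)) :
    (starRingEnd ℂ) (quantizer z (testVector f) (testVector g)) =
      ∫ u : ℝ, Complex.exp (2 * Real.pi * Complex.I * u * z.1) * pairFun f g (u, z.2) := by
  rw [quantizer_testVector hz, ← integral_conj]
  refine integral_congr_ae (Filter.Eventually.of_forall fun u => ?_)
  simp [pairFun, TestFunction.conj_apply, ← Complex.exp_conj, Complex.conj_ofNat]

/-- The quantizer is symmetric: `u ↦ -u` exchanges the two coordinates of `pairMap`. -/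
theorem conj_quantizer_testVector_eq {z : ℝ × ℝ} (hz : 0 < z.2) (f g : 𝓓(halfLine, ℂ)) :
    (starRingEnd ℂ) (quantizer z (testVector f) (testVector g)) =
      quantizer z (testVector g) (testVector f) := by
  rw [conj_quantizer_testVector hz, quantizer_testVector hz, ← integral_neg_eq_self]
  refine integral_congr_ae (Filter.Eventually.of_forall fun u => ?_)
  simp only [pairFun, pairMap, TestFunction.conj_apply, neg_neg]
  push_cast
  rw [mul_comm (f _)]
  congr 2
  ring

/-- The unitary operator from Hilbert–Schmidt operators to functions on `Π` that sends the operator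
`|φ⟩⟨ψ|` to the function `z ↦ conj ⟨φ, Ω(z) ψ⟩`. It is composed of the identification of
`|φ⟩⟨ψ|` with `φ ⊗ conj ψ`, the change of variables `pairMap` and the partial Fourier transform. -/
theorem exists_dequantization :
    ∃ W : HilbertSchmidt KSpace ≃ₗᵢ[ℂ] Lp ℂ 2 omegaMeasure, ∀ f g : 𝓓(halfLine, ℂ),
      W (ketBra (testVector f) (testVector g)) =ᵐ[omegaMeasure]
        fun z => (starRingEnd ℂ) (quantizer z (testVector f) (testVector g)) := by
  rw [omegaMeasure_eq_prod]
  have ht : IsTotalFamily fun p : KSpace × KSpace => Lp.tensor p.1 (star p.2) := fun v hv =>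
    Lp.isTotalFamily_tensor v fun p => by simpa using hv (p.1, star p.2)
  obtain ⟨T, hT⟩ := isTotalFamily_ketBra.exists_linearIsometryEquiv ht fun p q => by
    rw [Lp.inner_tensor, Lp.inner_star_star, inner_ketBra_ketBra]
  refine ⟨T.trans (pairUnitary.trans (partialFourierInv mulHaar)), fun f g => ?_⟩
  have h1 := hT (testVector f, testVector g)
  simp only at h1
  rw [LinearIsometryEquiv.trans_apply, LinearIsometryEquiv.trans_apply, h1,
    pairUnitary_tensor_testVector]
  filter_upwards [partialFourierInv_coeFn (memLp_pairFun f g) (integrable_pairFun f g),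
    Measure.quasiMeasurePreserving_snd.ae ae_mulHaar_pos] with z h2 hz
  rw [h2, conj_quantizer_testVector hz]

/-- The dequantization `A ↦ W_A`, as a unitary operator. -/
noncomputable def dequantization : HilbertSchmidt KSpace ≃ₗᵢ[ℂ] Lp ℂ 2 omegaMeasure :=
  exists_dequantization.choose

theorem dequantization_ketBra (f g : 𝓓(halfLine, ℂ)) :
    dequantization (ketBra (testVector f) (testVector g)) =ᵐ[omegaMeasure]
      fun z => (starRingEnd ℂ) (quantizer z (testVector f) (testVector g)) :=
  exists_dequantization.choose_spec f g

theorem ae_omegaMeasure_pos : ∀ᵐ z ∂omegaMeasure, 0 < z.2 := by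
  have h : ∀ᵐ z ∂omegaMeasure, z ∈ (halfPlane : Set (ℝ × ℝ)) := omegaMeasure_compl_halfPlane
  exact h

/-- The dequantization turns the adjoint into complex conjugation; on the operators `|φ⟩⟨ψ|` this is
the symmetry of the quantizer. -/
theorem dequantization_adj (A : HilbertSchmidt KSpace) :
    dequantization (adj A) = star (dequantization A) := by
  let S : HilbertSchmidt KSpace →L⋆[ℂ] Lp ℂ 2 omegaMeasure :=
    (dequantization.toContinuousLinearEquiv : HilbertSchmidt KSpace →L[ℂ] _).comp
      adj.toContinuousLinearMap
  let T : HilbertSchmidt KSpace →L⋆[ℂ] Lp ℂ 2 omegaMeasure :=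
    Lp.conjIsometry.toContinuousLinearMap.comp
      (dequantization.toContinuousLinearEquiv : HilbertSchmidt KSpace →L[ℂ] _)
  have hST : S = T := by
    refine isTotalFamily_ketBra_testVector.eq_of_semilinear S T fun p => ?_
    change dequantization (adj (ketBra _ _)) = star (dequantization (ketBra _ _))
    rw [adj_ketBra]
    ext1
    filter_upwards [dequantization_ketBra p.2 p.1, dequantization_ketBra p.1 p.2,
      Lp.coeFn_star (dequantization (ketBra (testVector p.1) (testVector p.2))),
      ae_omegaMeasure_pos] with z h1 h2 h3 hz
    rw [h1, h3, Pi.star_apply, h2, RCLike.star_def, RCLike.conj_conj,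
      conj_quantizer_testVector_eq hz]
  exact congrArg (fun S => S A) hST

theorem memLp_quantizer (f g : 𝓓(halfLine, ℂ)) :
    MemLp (fun z => quantizer z (testVector f) (testVector g)) 2 omegaMeasure := by
  refine (Lp.memLp (star (dequantization (ketBra (testVector f) (testVector g))))).ae_eq ?_
  filter_upwards [dequantization_ketBra f g,
    Lp.coeFn_star (dequantization (ketBra (testVector f) (testVector g)))] with z h1 h2
  rw [h2, Pi.star_apply, h1, RCLike.star_def, RCLike.conj_conj]

/-- Since `dequantization` is unitary, the matrix element `⟨φ, A ψ⟩ = ⟨|φ⟩⟨ψ|, A⟩` of the inverse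
image `A` of `F` is the inner product of `z ↦ conj ⟨φ, Ω(z) ψ⟩` with `F`. -/
theorem isQuantization_dequantization_symm (F : Lp ℂ 2 omegaMeasure) :
    IsQuantization F (toOp (dequantization.symm F)) := by
  intro φ ψ hφ hψ
  obtain ⟨f, rfl⟩ := isTestVector_iff.1 hφ
  obtain ⟨g, rfl⟩ := isTestVector_iff.1 hψ
  refine ⟨(memLp_quantizer f g).integrable_mul (Lp.memLp F), ?_⟩
  rw [← inner_ketBra, ← dequantization.inner_map_map, LinearIsometryEquiv.apply_symm_apply,
    L2.inner_def]
  refine integral_congr_ae ?_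
  filter_upwards [dequantization_ketBra f g] with z h1
  rw [h1, RCLike.inner_apply, RCLike.conj_conj, mul_comm]

theorem IsQuantization.congr_ae {f f' : ℝ × ℝ → ℂ} {A : KSpace →L[ℂ] KSpace}
    (h : IsQuantization f A) (hf : f =ᵐ[omegaMeasure] f') : IsQuantization f' A := by
  intro φ ψ hφ hψ
  obtain ⟨h1, h2⟩ := h φ ψ hφ hψ
  have h3 : (fun z => quantizer z φ ψ * f z) =ᵐ[omegaMeasure] fun z => quantizer z φ ψ * f' z := by
    filter_upwards [hf] with z hz
    rw [hz]
  exact ⟨h1.congr h3, h2.trans (integral_congr_ae h3)⟩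

theorem IsQuantization.unique {f : ℝ × ℝ → ℂ} {A B : KSpace →L[ℂ] KSpace}
    (hA : IsQuantization f A) (hB : IsQuantization f B) : A = B :=
  eq_of_forall_isTestVector fun φ ψ hφ hψ => (hA φ ψ hφ hψ).2.trans (hB φ ψ hφ hψ).2.symm

theorem HasTrace.unique {H : Type u} [NormedAddCommGroup H] [InnerProductSpace ℂ H]
    [CompleteSpace H] {T : H →L[ℂ] H} {c d : ℂ} (hc : HasTrace T c) (hd : HasTrace T d) : c = d :=
  (hc _ (HilbertSchmidt.basis H)).unique (hd _ (HilbertSchmidt.basis H))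

theorem hasTrace_dequantization_symm_comp (F : Lp ℂ 2 omegaMeasure) (A : HilbertSchmidt KSpace) :
    HasTrace (toOp (dequantization.symm F) ∘L toOp A)
      (∫ z, F z * dequantization A z ∂omegaMeasure) := by
  have h := hasTrace_comp (dequantization.symm F) A
  rwa [← dequantization.inner_map_map, dequantization_adj, LinearIsometryEquiv.apply_symm_apply,
    Lp.inner_star_eq_integral] at h

/-- The element of `L²(Π, dω)` given by a test function. -/
noncomputable def testSymbol (f : 𝓓(halfPlane, ℂ)) : Lp ℂ 2 omegaMeasure :=
  (f.memLp omegaMeasure_lt_top_of_isCompact 2).toLp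

theorem testSymbol_coeFn (f : 𝓓(halfPlane, ℂ)) : testSymbol f =ᵐ[omegaMeasure] f :=
  MemLp.coeFn_toLp _

theorem isQuantization_testSymbol (f : 𝓓(halfPlane, ℂ)) :
    IsQuantization f (toOp (dequantization.symm (testSymbol f))) :=
  (isQuantization_dequantization_symm _).congr_ae (testSymbol_coeFn f)

theorem integral_testSymbol_mul (f : 𝓓(halfPlane, ℂ)) (G : ℝ × ℝ → ℂ) :
    ∫ z, testSymbol f z * G z ∂omegaMeasure = ∫ z, f z * G z ∂omegaMeasure :=
  integral_congr_ae (by filter_upwards [testSymbol_coeFn f] with z hz; rw [hz])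

/-- The trace determines the integrals of `F` against all test functions, hence `F`. -/
theorem isDequantization_iff (A : HilbertSchmidt KSpace) (F : Lp ℂ 2 omegaMeasure) :
    IsDequantization (toOp A) F ↔ F = dequantization A := by
  constructor
  · intro h
    rw [← sub_eq_zero]
    refine TestFunction.eq_zero_of_forall_integral_mul_eq_zero omegaMeasure_lt_top_of_isCompact
      omegaMeasure_compl_halfPlane _ fun f => ?_
    obtain ⟨B, hB, hT⟩ := h f
    rw [hB.unique (isQuantization_testSymbol f)] at hT
    have h1 := hT.unique (hasTrace_dequantization_symm_comp (testSymbol f) A)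
    rw [integral_testSymbol_mul] at h1
    have hf := f.memLp omegaMeasure_lt_top_of_isCompact 2
    have hi : ∀ G : Lp ℂ 2 omegaMeasure, Integrable (fun z => f z * G z) omegaMeasure := fun G =>
      hf.integrable_mul (Lp.memLp G)
    rw [← sub_eq_zero, ← integral_sub (hi _) (hi _)] at h1
    rw [← h1]
    refine integral_congr_ae ?_
    filter_upwards [Lp.coeFn_sub F (dequantization A)] with z hz
    rw [hz, Pi.sub_apply, mul_sub]
  · rintro rfl f
    refine ⟨_, isQuantization_testSymbol f, ?_⟩
    rw [← integral_testSymbol_mul]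
    exact hasTrace_dequantization_symm_comp _ A

theorem mainTheorem2 :
    -- the integral that defines the quantizer converges
    (∀ z ∈ halfPlane, ∀ φ ψ : KSpace, IsTestVector φ → IsTestVector ψ →
      Integrable (quantizerIntegrand z φ ψ)) ∧
    -- traciality, tested against pairs of test functions
    (∀ f h : 𝓓(halfPlane, ℂ), ∃ A B : KSpace →L[ℂ] KSpace,
      IsQuantization f A ∧ IsQuantization h B ∧
        HasTrace (A ∘L B) (∫ z, f z * h z ∂omegaMeasure)) ∧
    -- quantization and dequantization
    ∃ (Q : Lp ℂ 2 omegaMeasure ≃ₗᵢ[ℂ] HilbertSchmidt KSpace)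
      (W : HilbertSchmidt KSpace ≃ₗᵢ[ℂ] Lp ℂ 2 omegaMeasure),
      (∀ (f : Lp ℂ 2 omegaMeasure) (A : KSpace →L[ℂ] KSpace),
        IsQuantization f A ↔ A = HilbertSchmidt.toOp (Q f)) ∧
      (∀ (A : HilbertSchmidt KSpace) (F : Lp ℂ 2 omegaMeasure),
        IsDequantization (HilbertSchmidt.toOp A) F ↔ F = W A) ∧
      (∀ f, W (Q f) = f) ∧ (∀ A, Q (W A) = A) ∧
      -- the reproducing property on the whole of L²
      (∀ f h : Lp ℂ 2 omegaMeasure,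
        HasTrace (HilbertSchmidt.toOp (Q f) ∘L HilbertSchmidt.toOp (Q h))
          (∫ z, f z * h z ∂omegaMeasure)) := by
  have htrace : ∀ F G : Lp ℂ 2 omegaMeasure,
      HasTrace (toOp (dequantization.symm F) ∘L toOp (dequantization.symm G))
        (∫ z, F z * G z ∂omegaMeasure) := fun F G => by
    have h := hasTrace_dequantization_symm_comp F (dequantization.symm G)
    rwa [LinearIsometryEquiv.apply_symm_apply] at h
  refine ⟨?_, ?_, dequantization.symm, dequantization, ?_, isDequantization_iff,
    dequantization.apply_symm_apply, dequantization.symm_apply_apply, htrace⟩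
  · intro z _ φ ψ hφ hψ
    obtain ⟨f, rfl⟩ := isTestVector_iff.1 hφ
    obtain ⟨g, rfl⟩ := isTestVector_iff.1 hψ
    exact integrable_quantizerIntegrand z f g
  · intro f h
    refine ⟨_, _, isQuantization_testSymbol f, isQuantization_testSymbol h, ?_⟩
    have h1 := htrace (testSymbol f) (testSymbol h)
    rw [integral_testSymbol_mul] at h1
    convert h1 using 1
    refine integral_congr_ae ?_
    filter_upwards [testSymbol_coeFn h] with z hz
    rw [hz]
  · intro F A
    refine ⟨fun h => h.unique (isQuantization_dequantization_symm F), ?_⟩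
    rintro rfl
    exact isQuantization_dequantization_symm F
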